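/- A biquiver $G$ is a finite directed graph with vertices $1,\dots,t$ ($t\ge 1$; loops and multiple arrows are allowed), each of whose arrows is either full or dashed. A representation $\mathcal A$ of $G$ assigns to each vertex $v$ a finite-dimensional complex vector space $\mathcal A_v$, to each full arrow $\alpha$ from $u$ to $v$ a linear mapping $\mathcal A_\alpha:\mathcal A_u\to\mathcal A_v$, and to each dashed arrow $\alpha$ from $u$ to $v$ a semilinear mapping $\mathcal A_\alpha:\mathcal A_u\to\mathcal A_v$ (an additive mapping with $\mathcal A_\alpha(cx)=\bar c\,\mathcal A_\alpha x$ for $c\in\mathbb C$). Its dimension is the vector $(\dim\mathcal A_1,\dots,\dim\mathcal A_t)$. An isomorphism $\mathcal A\to\mathcal B$ is a family of linear bijections $\mathcal F_v:\mathcal A_v\to\mathcal B_v$ such that $\mathcal B_\alpha\mathcal F_u=\mathcal F_v\mathcal A_\alpha$ for every arrow $\alpha$ from $u$ to $v$. The direct sum of two representations is formed by the spaces $\mathcal A_v\oplus\mathcal B_v$ and the mappings $\mathcal A_\alpha\oplus\mathcal B_\alpha$; a representation of nonzero dimension is indecomposable if it is not isomorphic to a direct sum of two representations of nonzero dimensions.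 $G$ is representation-finite if it has only finitely many indecomposable representations up to isomorphism. The Tits form of $G$ is the integral quadratic form $$q_G(x_1,\dots,x_t)=x_1^2+\dots+x_t^2-\sum x_ux_v,$$ where the sum is over all (full and dashed) arrows of $G$, $u$ and $v$ being the start and the end of the arrow. Theorem. Let $G$ be a connected biquiver with vertices $1,\dots,t$. (a) $G$ is representation-finite if and only if $G$ can be obtained from one of the Dynkin diagrams $A_n$ ($n\ge1$), $D_n$ ($n\ge 4$), $E_6$, $E_7$, $E_8$ by replacing each edge with a full or dashed arrow (of either direction), if and only if the Tits form $q_G$ is positive definite. (b) Let $G$ be representation-finite and let $z=(z_1,\dots,z_t)$ be an integer vector with nonnegative components. There exists an indecomposable representation of $G$ of dimension $z$ if and only if $q_G(z)=1$; this representation is determined by $z$ uniquely up to isomorphism. -/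

import Mathlib

/-- A biquiver with vertex set `V` and arrow set `E`: a directed graph (loops and multiple arrows
are allowed) each of whose arrows is either full (`dashed a = false`) or dashed
(`dashed a = true`). -/
structure Biquiver (V : Type*) (E : Type*) where
  /-- the vertex at which an arrow starts -/
  src : E → V
  /-- the vertex at which an arrow ends -/
  tgt : E → V
  /-- whether the arrow is dashed -/
  dashed : E → Bool

namespace Biquiver

universe u v

variable {V : Type u} {E : Type v}

/-- The underlying graph of `G`, with orientations, loops and multiplicities forgotten. -/
def toSimpleGraph (G : Biquiver V E) : SimpleGraph V :=
  SimpleGraph.fromRel fun x y => ∃ a, G.src a = x ∧ G.tgt a = y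

/-- A biquiver is connected if it is nonempty and any two of its vertices are joined by a path of
arrows, regardless of their directions. -/
def Connected (G : Biquiver V E) : Prop :=
  G.toSimpleGraph.Connected

/-- The ring homomorphism over which the mapping attached to the arrow `a` is semilinear: the
identity of `ℂ` if `a` is full, the complex conjugation if `a` is dashed. -/
noncomputable def twist (G : Biquiver V E) (a : E) : ℂ →+* ℂ :=
  if G.dashed a then starRingEnd ℂ else RingHom.id ℂ

/-- A (finite-dimensional) representation of a biquiver: a complex vector space for each vertex,
a linear mapping for each full arrow and a semilinear mapping for each dashed arrow. -/
structure Representation (G : Biquiver V E) where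
  /-- the vector space at a vertex -/
  space : V → Type
  [addCommGroup : ∀ x, AddCommGroup (space x)]
  [module : ∀ x, Module ℂ (space x)]
  [finiteDimensional : ∀ x, FiniteDimensional ℂ (space x)]
  /-- the linear or semilinear mapping of an arrow -/
  map : ∀ a, space (G.src a) →ₛₗ[G.twist a] space (G.tgt a)

attribute [instance] Representation.addCommGroup Representation.module
  Representation.finiteDimensional

namespace Representation

variable {G : Biquiver V E}

/-- The dimension of a representation, a vector indexed by the vertices. -/
noncomputable def dim (A : G.Representation) : V → ℕ :=
  fun x => Module.finrank ℂ (A.space x)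

/-- A morphism of representations: a family of linear mappings that commutes with the mappings of
all arrows. -/
structure Hom (A B : G.Representation) where
  /-- the linear mapping at a vertex -/
  app : ∀ x, A.space x →ₗ[ℂ] B.space x
  comm : ∀ a (w : A.space (G.src a)),
    B.map a (app (G.src a) w) = app (G.tgt a) (A.map a w)

/-- Two representations are isomorphic if there is a morphism between them that is bijective at
each vertex. -/
def Isomorphic (A B : G.Representation) : Prop :=
  ∃ F : Hom A B, ∀ x, Function.Bijective (F.app x)

/-- The direct sum of two representations. -/
noncomputable def directSum (A B : G.Representation) : G.Representation where
  space x := A.space x × B.space x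
  map a :=
    { toFun := fun w => (A.map a w.1, B.map a w.2)
      map_add' := fun w w' => by simp
      map_smul' := fun c w => by
        simp only [Prod.smul_fst, Prod.smul_snd, LinearMap.map_smulₛₗ, Prod.smul_mk] }

/-- A representation of nonzero dimension is indecomposable if it is not isomorphic to a direct
sum of representations of nonzero dimensions. -/
def Indecomposable (A : G.Representation) : Prop :=
  A.dim ≠ 0 ∧
    ¬ ∃ B C : G.Representation, B.dim ≠ 0 ∧ C.dim ≠ 0 ∧ A.Isomorphic (B.directSum C)

end Representation

/-- A biquiver is representation-finite if it has only finitely many indecomposable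
representations up to isomorphism. -/
def RepresentationFinite (G : Biquiver V E) : Prop :=
  ∃ S : Set G.Representation, S.Finite ∧
    ∀ A : G.Representation, A.Indecomposable → ∃ B ∈ S, A.Isomorphic B

/-- The Tits form of a biquiver, an integral quadratic form. -/
def titsForm [Fintype V] [Fintype E] (G : Biquiver V E) : QuadraticForm ℤ (V → ℤ) :=
  ∑ x, QuadraticMap.proj x x - ∑ a, QuadraticMap.proj (G.src a) (G.tgt a)

theorem titsForm_apply [Fintype V] [Fintype E] (G : Biquiver V E) (z : V → ℤ) :
    G.titsForm z = ∑ x, z x ^ 2 - ∑ a, z (G.src a) * z (G.tgt a) := by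
  simp [titsForm, sq]

/-- `G` is obtained from the graph `D` by replacing each edge with a full or dashed arrow (of
either direction): up to renaming the vertices, the arrows of `G` correspond one-to-one to the
edges of `D`, each arrow joining the endpoints of its edge. -/
def IsObtainedFrom (G : Biquiver V E) {W : Type*} (D : SimpleGraph W) : Prop :=
  ∃ (f : V ≃ W) (g : E ≃ D.edgeSet), ∀ a, (g a : Sym2 W) = s(f (G.src a), f (G.tgt a))

/-- The graph on `0, …, n - 1` consisting of the path `0 — 1 — ⋯ — (n - 2)` and an edge from
the last vertex `n - 1` to the vertex `k`. -/
def branchGraph (n k : ℕ) : SimpleGraph (Fin n) :=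
  SimpleGraph.fromRel fun i j =>
    (i.val + 1 = j.val ∧ j.val + 1 < n) ∨ (i.val = k ∧ j.val + 1 = n)

/-- The Dynkin diagram `A_n`, meant for `1 ≤ n`. -/
def dynkinA (n : ℕ) : SimpleGraph (Fin n) :=
  SimpleGraph.pathGraph n

/-- The Dynkin diagram `D_n`, meant for `4 ≤ n`. -/
def dynkinD (n : ℕ) : SimpleGraph (Fin n) :=
  branchGraph n (n - 3)

/-- The Dynkin diagram `E_n`, meant for `n = 6, 7, 8`. -/
def dynkinE (n : ℕ) : SimpleGraph (Fin n) :=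
  branchGraph n 2

/-- `G` is obtained from one of the Dynkin diagrams `A_n`, `D_n`, `E_6`, `E_7`, `E_8` by replacing
each edge with a full or dashed arrow. -/
def IsDynkin (G : Biquiver V E) : Prop :=
  (∃ n, 1 ≤ n ∧ G.IsObtainedFrom (dynkinA n)) ∨
  (∃ n, 4 ≤ n ∧ G.IsObtainedFrom (dynkinD n)) ∨
  G.IsObtainedFrom (dynkinE 6) ∨
  G.IsObtainedFrom (dynkinE 7) ∨
  G.IsObtainedFrom (dynkinE 8)

end Biquiver

/-! The proof works with real dimensions, since a complex multiple of a morphism need not commute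
with semilinear mappings. For representations A and B, sending a family f to B_α f − f A_α is the
real linear map `defect A B`, with kernel Hom(A, B) and cokernel Ext(A, B). Rank–nullity gives 2⟨dim
A, dim B⟩ = dim_ℝ Hom(A, B) − dim_ℝ Ext(A, B), where ⟨·,·⟩ is the Euler form and q(z) = ⟨z, z⟩.

Suppose that q is positive definite and G connected. Then G is a tree, so conjugation at suitable
vertices turns every dashed arrow into a full one (`exists_isUntwisting`); only the resulting action
of ℂ by endomorphisms is used. By Ringel's argument (`Indecomposable.exists_smaller_self_extension`)
an indecomposable with a nonzero noninvertible endomorphism yields a smaller indecomposable Y with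
Ext(Y, Y) ≠ 0. By induction End Y = ℂ, so 2 ≤ 2q(dim Y) = 2 − dim Ext(Y, Y), which is absurd. Hence
every indecomposable X has End X = ℂ, Ext(X, X) = 0 and q(dim X) = 1. Conversely, if q(z) = 1, a
representation of dimension z with the fewest endomorphisms is indecomposable. Two indecomposables
of equal dimension lie on a real line of representations; neither has self-extensions, so each is
isomorphic to almost every point of the line, and they are isomorphic. Since q has finitely many
roots, G is representation-finite.

Suppose that G is representation-finite. For each z ≠ 0 the space of representations of dimension z
is a finite union of isomorphism classes. Each is an orbit on which real scalars act trivially, so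
its Hausdorff dimension is at least one below that of the space of families of matrices. Comparing
dimensions gives q(z) > 0.

The link with Dynkin diagrams is combinatorial. A positive subadditive function that is not additive
proves positivity on each diagram. In the other direction, a longest path together with the null
vectors of the extended diagrams leaves only the Dynkin shapes. -/

namespace Biquiver

universe u v

variable {V : Type u} {E : Type v} {G : Biquiver V E}

/-! ### Real spaces of morphisms and the Euler form -/

theorem twist_ofReal (G : Biquiver V E) (a : E) (r : ℝ) : G.twist a (r : ℂ) = r := by
  unfold twist; split_ifs <;> simp

/-- Conjugation fixes the reals, so all arrow mappings are ℝ-linear; this is why Hom and Ext are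
taken over ℝ. -/
theorem map_real_smul {M N : Type*} [AddCommGroup M] [AddCommGroup N] [Module ℂ M] [Module ℂ N]
    {a : E} (f : M →ₛₗ[G.twist a] N) (r : ℝ) (w : M) : f (r • w) = r • f w := by
  rw [← Complex.coe_smul, LinearMap.map_smulₛₗ, twist_ofReal, Complex.coe_smul]

section Semilinear

variable {M N L : Type*} [AddCommGroup M] [AddCommGroup N] [AddCommGroup L]
  [Module ℂ M] [Module ℂ N] [Module ℂ L]

/-- A semilinear mapping is determined by its values on a basis, which are arbitrary. -/
noncomputable def semilinearEquiv {ι : Type*} [Fintype ι] (b : Module.Basis ι ℂ M)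
    (σ : ℂ →+* ℂ) : (M →ₛₗ[σ] N) ≃ₗ[ℝ] (ι → N) where
  toFun f i := f (b i)
  map_add' f g := rfl
  map_smul' r f := rfl
  invFun y :=
    { toFun := fun w => ∑ i, σ (b.repr w i) • y i
      map_add' := fun w w' => by simp [add_smul, Finset.sum_add_distrib]
      map_smul' := fun c w => by simp [mul_smul, Finset.smul_sum] }
  left_inv f := by
    ext w
    conv_rhs => rw [← b.sum_repr w, map_sum]
    exact Finset.sum_congr rfl fun i _ => (f.map_smulₛₗ _ _).symm
  right_inv y := by
    classical
    ext i
    simp [Finsupp.single_apply, apply_ite σ]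

instance semilinear_finite [FiniteDimensional ℂ M] [FiniteDimensional ℂ N] (σ : ℂ →+* ℂ) :
    Module.Finite ℝ (M →ₛₗ[σ] N) :=
  have : Module.Finite ℝ N := Module.Finite.trans ℂ N
  Module.Finite.equiv (semilinearEquiv (Module.finBasis ℂ M) σ).symm

theorem finrank_semilinear [FiniteDimensional ℂ M] [FiniteDimensional ℂ N] (σ : ℂ →+* ℂ) :
    Module.finrank ℝ (M →ₛₗ[σ] N) = 2 * (Module.finrank ℂ M * Module.finrank ℂ N) := by
  have : Module.Finite ℝ N := Module.Finite.trans ℂ N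
  rw [(semilinearEquiv (Module.finBasis ℂ M) σ).finrank_eq, Module.finrank_pi_fintype]
  simp [finrank_real_of_complex]
  ring

/-- A linear mapping of vector spaces has a generalized inverse. -/
theorem exists_generalized_inverse (g : M →ₗ[ℂ] N) :
    ∃ s : N →ₗ[ℂ] M, ∀ w, g (s (g w)) = g w := by
  obtain ⟨s, hs⟩ := g.rangeRestrict.exists_rightInverse_of_surjective g.range_rangeRestrict
  obtain ⟨t, ht⟩ := LinearMap.exists_extend s
  refine ⟨t, fun w => ?_⟩
  have h1 : t (g w) = s (g.rangeRestrict w) := LinearMap.congr_fun ht (g.rangeRestrict w)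
  have h2 := LinearMap.congr_fun hs (g.rangeRestrict w)
  rw [h1]
  exact congrArg Subtype.val h2

/-- A semilinear mapping factors through a linear mapping with smaller kernel. -/
theorem exists_semilinear_factor {σ : ℂ →+* ℂ} (g : M →ₗ[ℂ] N) (h : M →ₛₗ[σ] L)
    (hk : ∀ w, g w = 0 → h w = 0) : ∃ k : N →ₛₗ[σ] L, ∀ w, k (g w) = h w := by
  obtain ⟨s, hs⟩ := exists_generalized_inverse g
  refine ⟨h.comp s, fun w => ?_⟩
  -- `s` inverts `g` only up to the kernel of `g`, which `h` kills.
  have := hk (s (g w) - w) (by rw [map_sub, hs, sub_self])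
  rw [map_sub, sub_eq_zero] at this
  simpa using this

end Semilinear

namespace Representation

variable {A B C D : G.Representation}

/-- The families of linear mappings between the spaces of two representations. -/
abbrev Family (A B : G.Representation) := ∀ x, A.space x →ₗ[ℂ] B.space x

/-- The families of semilinear mappings of the same kind as the mappings of a representation. -/
abbrev ArrowFamily (A B : G.Representation) :=
  ∀ a, A.space (G.src a) →ₛₗ[G.twist a] B.space (G.tgt a)

/-- The real linear mapping whose kernel consists of the morphisms from `A` to `B`; its cokernel
is the space of extensions of `A` by `B`. -/
noncomputable def defect (A B : G.Representation) : Family A B →ₗ[ℝ] ArrowFamily A B where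
  toFun f a := (B.map a).comp (f (G.src a)) - (f (G.tgt a)).comp (A.map a)
  map_add' f g := by
    funext a; ext w; simp; abel
  map_smul' r f := by
    funext a; ext w
    simp [map_real_smul, smul_sub]

theorem defect_apply (f : Family A B) (a : E) (w : A.space (G.src a)) :
    defect A B f a w = B.map a (f (G.src a) w) - f (G.tgt a) (A.map a w) := rfl

/-- The real vector space of morphisms from `A` to `B`. -/
noncomputable abbrev homSpace (A B : G.Representation) : Submodule ℝ (Family A B) :=
  LinearMap.ker (defect A B)

theorem mem_homSpace {f : Family A B} :
    f ∈ homSpace A B ↔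
      ∀ a w, B.map a (f (G.src a) w) = f (G.tgt a) (A.map a w) := by
  rw [LinearMap.mem_ker]
  constructor
  · intro h a w
    have := LinearMap.congr_fun (congrFun h a) w
    rwa [defect_apply, Pi.zero_apply, LinearMap.zero_apply, sub_eq_zero] at this
  · intro h
    funext a; ext w
    rw [defect_apply, h, sub_self]; rfl

/-- The composition of families. -/
noncomputable def Family.comp (g : Family B C) (f : Family A B) : Family A C :=
  fun x => (g x).comp (f x)

@[simp] theorem Family.comp_apply (g : Family B C) (f : Family A B) (x : V) (w : A.space x) :
    g.comp f x w = g x (f x w) := rfl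

/-- The identity family. -/
noncomputable def Family.id (A : G.Representation) : Family A A := fun _ => LinearMap.id

@[simp] theorem Family.id_apply (x : V) (w : A.space x) : Family.id A x w = w := rfl

theorem id_mem_homSpace (A : G.Representation) : Family.id A ∈ homSpace A A :=
  mem_homSpace.2 fun _ _ => rfl

theorem comp_mem_homSpace {g : Family B C} {f : Family A B} (hg : g ∈ homSpace B C)
    (hf : f ∈ homSpace A B) : g.comp f ∈ homSpace A C := by
  rw [mem_homSpace] at *
  intro a w
  rw [Family.comp_apply, Family.comp_apply, hg, hf]

theorem isomorphic_iff :
    A.Isomorphic B ↔ ∃ f ∈ homSpace A B, ∀ x, Function.Bijective (f x) :=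
  ⟨fun ⟨F, h⟩ => ⟨F.app, mem_homSpace.2 F.comm, h⟩, fun ⟨f, hf, h⟩ => ⟨⟨f, mem_homSpace.1 hf⟩, h⟩⟩

theorem Isomorphic.trans (h : A.Isomorphic B) (h' : B.Isomorphic C) : A.Isomorphic C := by
  rw [isomorphic_iff] at *
  obtain ⟨f, hf, hb⟩ := h
  obtain ⟨g, hg, hb'⟩ := h'
  exact ⟨g.comp f, comp_mem_homSpace hg hf, fun x => (hb' x).comp (hb x)⟩

/-- The inverse of a bijective morphism. -/
theorem exists_inverse {f : Family A B} (hf : f ∈ homSpace A B)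
    (hb : ∀ x, Function.Bijective (f x)) :
    ∃ g ∈ homSpace B A, (∀ x w, g x (f x w) = w) ∧ ∀ x w, f x (g x w) = w := by
  let e := fun x => LinearEquiv.ofBijective (f x) (hb x)
  have h1 : ∀ x w, f x ((e x).symm w) = w := fun x w => (e x).apply_symm_apply w
  have h2 : ∀ x w, (e x).symm (f x w) = w := fun x w => (e x).symm_apply_apply w
  refine ⟨fun x => (e x).symm, mem_homSpace.2 fun a w => ?_, h2, h1⟩
  apply (hb _).1
  have := mem_homSpace.1 hf a ((e (G.src a)).symm w)
  rw [h1] at this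
  rw [LinearEquiv.coe_coe, LinearEquiv.coe_coe, ← this, h1]

theorem Isomorphic.symm (h : A.Isomorphic B) : B.Isomorphic A := by
  rw [isomorphic_iff] at *
  obtain ⟨f, hf, hb⟩ := h
  obtain ⟨g, hg, h1, h2⟩ := exists_inverse hf hb
  exact ⟨g, hg, fun x => ⟨Function.LeftInverse.injective (h2 x),
    Function.RightInverse.surjective (h1 x)⟩⟩

theorem Isomorphic.dim_eq (h : A.Isomorphic B) : A.dim = B.dim := by
  rw [isomorphic_iff] at h
  obtain ⟨f, -, hb⟩ := h
  funext x
  exact (LinearEquiv.ofBijective (f x) (hb x)).finrank_eq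

theorem Indecomposable.of_isomorphic (h : A.Isomorphic B) (hA : A.Indecomposable) :
    B.Indecomposable :=
  ⟨h.dim_eq ▸ hA.1, fun ⟨C, D, hC, hD, hBCD⟩ => hA.2 ⟨C, D, hC, hD, h.trans hBCD⟩⟩

theorem dim_directSum (A B : G.Representation) : (A.directSum B).dim = A.dim + B.dim := by
  funext x
  exact Module.finrank_prod (R := ℂ) (M := A.space x) (M' := B.space x)

theorem dim_eq_zero_iff (A : G.Representation) :
    A.dim = 0 ↔ ∀ x (w : A.space x), w = 0 := by
  constructor
  · intro h x w
    have : Subsingleton (A.space x) := Module.finrank_zero_iff.1 (congrFun h x)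
    exact Subsingleton.elim _ _
  · intro h
    funext x
    have : Subsingleton (A.space x) := ⟨fun a b => by rw [h x a, h x b]⟩
    exact Module.finrank_zero_iff.2 this

section Euler

theorem finrank_family [Fintype V] (A B : G.Representation) :
    Module.finrank ℝ (Family A B) = 2 * ∑ x, A.dim x * B.dim x := by
  rw [Module.finrank_pi_fintype, Finset.mul_sum]
  exact Finset.sum_congr rfl fun x _ => finrank_semilinear _

theorem finrank_arrowFamily [Fintype E] (A B : G.Representation) :
    Module.finrank ℝ (ArrowFamily A B) = 2 * ∑ a, A.dim (G.src a) * B.dim (G.tgt a) := by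
  rw [Module.finrank_pi_fintype, Finset.mul_sum]
  exact Finset.sum_congr rfl fun x _ => finrank_semilinear _

variable [Fintype V] [Fintype E]

/-- The Euler form of a biquiver. -/
def eulerForm (G : Biquiver V E) (y z : V → ℕ) : ℤ :=
  ∑ x, (y x : ℤ) * z x - ∑ a, (y (G.src a) : ℤ) * z (G.tgt a)

/-- Rank–nullity for `defect A B`. The factor 2 is the degree of ℂ over ℝ. -/
theorem euler_eq (A B : G.Representation) :
    2 * eulerForm G A.dim B.dim =
      (Module.finrank ℝ (homSpace A B) : ℤ)
        - (Module.finrank ℝ (ArrowFamily A B ⧸ LinearMap.range (defect A B)) : ℤ) := by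
  have h1 := LinearMap.finrank_range_add_finrank_ker (defect A B)
  have h2 := Submodule.finrank_quotient_add_finrank (LinearMap.range (defect A B))
  rw [finrank_family] at h1
  rw [finrank_arrowFamily] at h2
  unfold eulerForm
  zify at h1 h2
  linarith

theorem euler_le (A B : G.Representation) :
    2 * eulerForm G A.dim B.dim ≤ Module.finrank ℝ (homSpace A B) := by
  rw [euler_eq]; omega

theorem euler_eq_of_surjective (h : Function.Surjective (defect A B)) :
    2 * eulerForm G A.dim B.dim = Module.finrank ℝ (homSpace A B) := by
  rw [euler_eq, LinearMap.range_eq_top.2 h]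
  have : Module.finrank ℝ (ArrowFamily A B ⧸ (⊤ : Submodule ℝ (ArrowFamily A B))) = 0 :=
    Module.finrank_zero_of_subsingleton
  rw [this]; simp

theorem surjective_of_euler_eq
    (h : 2 * eulerForm G A.dim B.dim = Module.finrank ℝ (homSpace A B)) :
    Function.Surjective (defect A B) := by
  rw [euler_eq] at h
  have h0 : Module.finrank ℝ (ArrowFamily A B ⧸ LinearMap.range (defect A B)) = 0 := by omega
  rw [← LinearMap.range_eq_top, ← Submodule.Quotient.subsingleton_iff]
  exact Module.finrank_zero_iff.1 h0

theorem titsForm_eq_eulerForm (z : V → ℕ) :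
    G.titsForm (fun x => (z x : ℤ)) = eulerForm G z z := by
  rw [titsForm_apply, eulerForm]
  simp [sq]

end Euler

end Representation

end Biquiver

/-! ### Direct summands, Fitting's lemma and Ringel's argument -/

namespace Biquiver

universe u v

variable {V : Type u} {E : Type v} {G : Biquiver V E}

theorem exists_minimal_measure {α : Type*} {P : α → Prop} (m : α → ℕ) (h : ∃ a, P a) :
    ∃ a, P a ∧ ∀ b, P b → m a ≤ m b := by
  obtain ⟨a, ha, hmin⟩ := (measure m).wf.has_min {a | P a} h
  exact ⟨a, ha, fun b hb => not_lt.1 (hmin b hb)⟩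

namespace Representation

variable {A B C D X Y : G.Representation}

/-- The subrepresentation on an invariant family of subspaces. -/
noncomputable def sub (A : G.Representation) (N : ∀ x, Submodule ℂ (A.space x))
    (h : ∀ a, ∀ w ∈ N (G.src a), A.map a w ∈ N (G.tgt a)) : G.Representation where
  space x := N x
  map a :=
    { toFun := fun w => ⟨A.map a w, h a w w.2⟩
      map_add' := fun w w' => by ext; simp
      map_smul' := fun c w => by ext; simp [LinearMap.map_smulₛₗ] }

/-- The inclusion of a subrepresentation. -/
noncomputable def subtype (A : G.Representation) (N : ∀ x, Submodule ℂ (A.space x))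
    (h : ∀ a, ∀ w ∈ N (G.src a), A.map a w ∈ N (G.tgt a)) : Family (A.sub N h) A :=
  fun x => (N x).subtype

theorem subtype_mem_homSpace (N : ∀ x, Submodule ℂ (A.space x))
    (h : ∀ a, ∀ w ∈ N (G.src a), A.map a w ∈ N (G.tgt a)) :
    A.subtype N h ∈ homSpace (A.sub N h) A :=
  mem_homSpace.2 fun _ _ => rfl

theorem isomorphic_directSum_of_isCompl {N N' : ∀ x, Submodule ℂ (A.space x)}
    (h : ∀ a, ∀ w ∈ N (G.src a), A.map a w ∈ N (G.tgt a))
    (h' : ∀ a, ∀ w ∈ N' (G.src a), A.map a w ∈ N' (G.tgt a)) (hc : ∀ x, IsCompl (N x) (N' x)) :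
    A.Isomorphic ((A.sub N h).directSum (A.sub N' h')) := by
  refine Isomorphic.symm (isomorphic_iff.2
    ⟨fun x => ((N x).prodEquivOfIsCompl (N' x) (hc x)).toLinearMap, mem_homSpace.2 fun a w => ?_,
      fun x => ((N x).prodEquivOfIsCompl (N' x) (hc x)).bijective⟩)
  exact map_add (A.map a) (w.1.1 : A.space (G.src a)) (w.2.1 : A.space (G.src a))

theorem Indecomposable.eq_bot_or_eq_bot (hA : A.Indecomposable)
    {N N' : ∀ x, Submodule ℂ (A.space x)}
    (h : ∀ a, ∀ w ∈ N (G.src a), A.map a w ∈ N (G.tgt a))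
    (h' : ∀ a, ∀ w ∈ N' (G.src a), A.map a w ∈ N' (G.tgt a)) (hc : ∀ x, IsCompl (N x) (N' x)) :
    (∀ x, N x = ⊥) ∨ ∀ x, N' x = ⊥ := by
  by_contra! hcon
  obtain ⟨⟨x, hx⟩, ⟨y, hy⟩⟩ := hcon
  refine hA.2 ⟨_, _, fun h0 => hx ?_, fun h0 => hy ?_, isomorphic_directSum_of_isCompl h h' hc⟩
  · rw [dim_eq_zero_iff] at h0
    exact (Submodule.eq_bot_iff _).2 fun w hw => congrArg Subtype.val (h0 x ⟨w, hw⟩)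
  · rw [dim_eq_zero_iff] at h0
    exact (Submodule.eq_bot_iff _).2 fun w hw => congrArg Subtype.val (h0 y ⟨w, hw⟩)

/-- The first inclusion of a direct sum. -/
noncomputable def inl (A B : G.Representation) : Family A (A.directSum B) :=
  fun x => LinearMap.inl ℂ (A.space x) (B.space x)

/-- The second inclusion of a direct sum. -/
noncomputable def inr (A B : G.Representation) : Family B (A.directSum B) :=
  fun x => LinearMap.inr ℂ (A.space x) (B.space x)

/-- The first projection of a direct sum. -/
noncomputable def fst (A B : G.Representation) : Family (A.directSum B) A :=
  fun x => LinearMap.fst ℂ (A.space x) (B.space x)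

/-- The second projection of a direct sum. -/
noncomputable def snd (A B : G.Representation) : Family (A.directSum B) B :=
  fun x => LinearMap.snd ℂ (A.space x) (B.space x)

theorem inl_mem_homSpace (A B : G.Representation) : inl A B ∈ homSpace A (A.directSum B) :=
  mem_homSpace.2 fun a _ => Prod.ext rfl (map_zero (B.map a))

theorem inr_mem_homSpace (A B : G.Representation) : inr A B ∈ homSpace B (A.directSum B) :=
  mem_homSpace.2 fun a _ => Prod.ext (map_zero (A.map a)) rfl

theorem fst_mem_homSpace (A B : G.Representation) : fst A B ∈ homSpace (A.directSum B) A :=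
  mem_homSpace.2 fun _ _ => rfl

theorem snd_mem_homSpace (A B : G.Representation) : snd A B ∈ homSpace (A.directSum B) B :=
  mem_homSpace.2 fun _ _ => rfl

theorem ker_invariant {f : Family A B} (hf : f ∈ homSpace A B) (a : E) :
    ∀ w ∈ LinearMap.ker (f (G.src a)), A.map a w ∈ LinearMap.ker (f (G.tgt a)) := by
  intro w hw
  rw [LinearMap.mem_ker] at *
  rw [← mem_homSpace.1 hf, hw, map_zero]

theorem range_invariant {f : Family A B} (hf : f ∈ homSpace A B) (a : E) :
    ∀ w ∈ LinearMap.range (f (G.src a)), B.map a w ∈ LinearMap.range (f (G.tgt a)) := by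
  rintro _ ⟨w, rfl⟩
  exact ⟨A.map a w, (mem_homSpace.1 hf a w).symm⟩

/-- A nonzero retract of an indecomposable representation is the whole representation. -/
theorem Indecomposable.bijective_of_retract (hX : X.Indecomposable) (hY : Y.dim ≠ 0)
    {i : Family Y X} {r : Family X Y} (hi : i ∈ homSpace Y X) (hr : r ∈ homSpace X Y)
    (hri : ∀ x w, r x (i x w) = w) (x : V) : Function.Bijective (i x) := by
  -- The idempotent `i ∘ r` splits `X` into its image and its kernel.
  have hc : ∀ x, IsCompl (LinearMap.range (i x)) (LinearMap.ker (r x)) := by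
    intro x
    rw [isCompl_iff, Submodule.disjoint_def, codisjoint_iff, Submodule.eq_top_iff']
    refine ⟨?_, fun w => ?_⟩
    · rintro _ ⟨w, rfl⟩ hw
      rw [LinearMap.mem_ker, hri] at hw
      rw [hw, map_zero]
    · refine Submodule.mem_sup.2 ⟨i x (r x w), ⟨_, rfl⟩, w - i x (r x w), ?_, by abel⟩
      rw [LinearMap.mem_ker, map_sub, hri, sub_self]
  rcases hX.eq_bot_or_eq_bot (range_invariant hi) (ker_invariant hr) hc with h | h
  · refine (hY ((dim_eq_zero_iff Y).2 fun x w => ?_)).elim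
    have : i x w = 0 := by
      rw [← Submodule.mem_bot ℂ, ← h x]; exact ⟨w, rfl⟩
    rw [← hri x w, this, map_zero]
  · refine ⟨Function.LeftInverse.injective (hri x), fun w => ⟨r x w, ?_⟩⟩
    exact LinearMap.ker_eq_bot.1 (h x) (hri x _)

theorem pow_mem_homSpace {f : Family A A} (hf : f ∈ homSpace A A) (n : ℕ) :
    (fun x => f x ^ n : Family A A) ∈ homSpace A A := by
  induction n with
  | zero => exact id_mem_homSpace A
  | succ n ih =>
    have : (fun x => f x ^ (n + 1) : Family A A) = Family.comp (fun x => f x ^ n) f := by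
      funext x; rw [pow_succ]; rfl
    rw [this]
    exact comp_mem_homSpace ih hf

/-- Fitting's lemma: an endomorphism of an indecomposable representation is bijective or
nilpotent. -/
theorem Indecomposable.bijective_or_nilpotent [Finite V] (hX : X.Indecomposable)
    {f : Family X X} (hf : f ∈ homSpace X X) :
    (∀ x, Function.Bijective (f x)) ∨ ∃ n, ∀ x, f x ^ (n + 1) = 0 := by
  have h1 : ∀ᶠ n in Filter.atTop, ∀ x,
      IsCompl (LinearMap.ker (f x ^ n)) (LinearMap.range (f x ^ n)) :=
    Filter.eventually_all.2 fun x => (f x).eventually_isCompl_ker_pow_range_pow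
  -- Finiteness of `V` gives one exponent for all vertices. It is taken positive so that the kernel
  -- of `f x` lies in that of the power.
  obtain ⟨n, hn, hpos⟩ := (h1.and (Filter.eventually_gt_atTop 0)).exists
  obtain ⟨n, rfl⟩ := Nat.exists_eq_succ_of_ne_zero hpos.ne'
  have hm := pow_mem_homSpace hf (n + 1)
  rcases hX.eq_bot_or_eq_bot (ker_invariant hm) (range_invariant hm) hn with h | h
  · left
    intro x
    have hinj : Function.Injective (f x) := by
      rw [← LinearMap.ker_eq_bot, eq_bot_iff, ← h x]
      intro w hw
      rw [LinearMap.mem_ker] at *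
      rw [pow_succ, Module.End.mul_apply, hw, map_zero]
    exact ⟨hinj, LinearMap.injective_iff_surjective.1 hinj⟩
  · right
    exact ⟨n, fun x => LinearMap.range_eq_bot.1 (h x)⟩

section Ringel

variable [Fintype V]

/-- The sum of the dimensions of the spaces of a representation. -/
noncomputable def totalDim (A : G.Representation) : ℕ := ∑ x, A.dim x

/-- The sum of the ranks of the mappings of a family. -/
noncomputable def Family.rank (f : Family A B) : ℕ :=
  ∑ x, Module.finrank ℂ (LinearMap.range (f x))

theorem totalDim_directSum (A B : G.Representation) :
    (A.directSum B).totalDim = A.totalDim + B.totalDim := by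
  simp [totalDim, dim_directSum, Finset.sum_add_distrib]

theorem Isomorphic.totalDim_eq (h : A.Isomorphic B) : A.totalDim = B.totalDim := by
  rw [totalDim, totalDim, h.dim_eq]

theorem totalDim_pos (h : A.dim ≠ 0) : 0 < A.totalDim := by
  rw [Nat.pos_iff_ne_zero]
  intro h0
  refine h (funext fun x => ?_)
  exact Finset.sum_eq_zero_iff.1 h0 x (Finset.mem_univ x)

theorem rank_lt_totalDim {f : Family A A} (h : ¬ ∀ x, Function.Bijective (f x)) :
    f.rank < A.totalDim := by
  push Not at h
  obtain ⟨x, hx⟩ := h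
  refine Finset.sum_lt_sum (fun y _ => Submodule.finrank_le _) ⟨x, Finset.mem_univ x, ?_⟩
  refine Submodule.finrank_lt fun htop => hx ?_
  have hs := LinearMap.range_eq_top.1 htop
  exact ⟨LinearMap.injective_iff_surjective.2 hs, hs⟩

theorem rank_eq_totalDim {f : Family A A} (h : ∀ x, Function.Bijective (f x)) :
    f.rank = A.totalDim := by
  refine Finset.sum_congr rfl fun x _ => ?_
  rw [LinearMap.range_eq_top.2 (h x).2, finrank_top]; rfl

theorem rank_comp_le (g : Family B C) (f : Family A B) : (g.comp f).rank ≤ f.rank := by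
  refine Finset.sum_le_sum fun x _ => ?_
  rw [Family.comp, LinearMap.range_comp]
  exact Submodule.finrank_map_le _ _

/-- If a composition has the same rank as its first factor then it has the same kernel. -/
theorem eq_zero_of_rank_comp_eq {g : Family B C} {f : Family A B}
    (h : f.rank ≤ (g.comp f).rank) (x : V) (w : A.space x) (hw : g x (f x w) = 0) :
    f x w = 0 := by
  have hle : ∀ x ∈ Finset.univ, Module.finrank ℂ (LinearMap.range (g.comp f x)) ≤
      Module.finrank ℂ (LinearMap.range (f x)) := by
    intro x _
    rw [Family.comp, LinearMap.range_comp]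
    exact Submodule.finrank_map_le _ _
  have heq := (Finset.sum_eq_sum_iff_of_le hle).1 (le_antisymm (Finset.sum_le_sum hle) h) x
    (Finset.mem_univ x)
  have h1 := LinearMap.finrank_range_add_finrank_ker (f x)
  have h2 := LinearMap.finrank_range_add_finrank_ker (g.comp f x)
  have h3 : LinearMap.ker (f x) = LinearMap.ker (g.comp f x) :=
    Submodule.eq_of_le_of_finrank_eq (LinearMap.ker_le_ker_comp _ _) (by omega)
  rw [← LinearMap.mem_ker, h3]
  exact hw

/-- An indecomposable representation with a nonzero nonbijective endomorphism has a smaller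
indecomposable subquotient with self-extensions. -/
theorem Indecomposable.exists_smaller_self_extension (hX : X.Indecomposable)
    {θ₀ : Family X X} (h0 : θ₀ ∈ homSpace X X) (hne : θ₀ ≠ 0)
    (hnb : ¬ ∀ x, Function.Bijective (θ₀ x)) :
    ∃ Y : G.Representation, Y.Indecomposable ∧ Y.totalDim < X.totalDim ∧
      ¬ Function.Surjective (defect Y Y) := by
  obtain ⟨θ, ⟨hθ, hθ0⟩, hmin⟩ := exists_minimal_measure
    (P := fun f : Family X X => f ∈ homSpace X X ∧ f ≠ 0) Family.rank ⟨θ₀, h0, hne⟩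
  have hθnb : ¬ ∀ x, Function.Bijective (θ x) := fun h =>
    absurd (hmin θ₀ ⟨h0, hne⟩) (not_le.2 (by
      rw [rank_eq_totalDim h]; exact rank_lt_totalDim hnb))
  obtain ⟨n, hn⟩ := (hX.bijective_or_nilpotent hθ).resolve_left hθnb
  -- If the square were nonzero, minimality of the rank would give it the same kernel as `θ`; then
  -- all powers would share that kernel, against nilpotency.
  have hsq : ∀ x w, θ x (θ x w) = 0 := by
    by_contra! hcon
    obtain ⟨x, w, hw⟩ := hcon
    have hker : ∀ x w, θ x (θ x w) = 0 → θ x w = 0 := eq_zero_of_rank_comp_eq (hmin _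
      ⟨comp_mem_homSpace hθ hθ, fun h => hw (LinearMap.congr_fun (congrFun h x) w)⟩)
    have : ∀ m w, (θ x ^ (m + 1)) w = 0 → θ x w = 0 := by
      intro m
      induction m with
      | zero => intro w hw; simpa using hw
      | succ m ih =>
        intro w hw
        rw [pow_succ] at hw
        exact hker x w (ih _ hw)
    exact hw (by rw [this n w (by rw [hn]; rfl), map_zero])
  -- the kernel of `θ`, and `θ` as a morphism to it
  let K := X.sub (fun x => LinearMap.ker (θ x)) (ker_invariant hθ)
  let ι : Family K X := X.subtype (fun x => LinearMap.ker (θ x)) (ker_invariant hθ)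
  have hι : ι ∈ homSpace K X := subtype_mem_homSpace _ _
  have hιinj : ∀ x w, ι x w = 0 → w = 0 := fun x w h => Subtype.ext h
  let θ' : Family X K := fun x => (θ x).codRestrict _ fun w => hsq x w
  have hιθ : ∀ x w, ι x (θ' x w) = θ x w := fun x w => rfl
  have hθ' : θ' ∈ homSpace X K := mem_homSpace.2 fun a w => Subtype.ext (mem_homSpace.1 hθ a w)
  have hKX : K.totalDim < X.totalDim := by
    refine lt_of_le_of_ne (Finset.sum_le_sum fun x _ => Submodule.finrank_le _) fun h => hθ0 ?_
    funext x
    have := (Finset.sum_eq_sum_iff_of_le fun x _ => Submodule.finrank_le _).1 h x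
      (Finset.mem_univ x)
    exact LinearMap.ker_eq_top.1 (Submodule.eq_top_of_finrank_eq this)
  -- `Y` is a smallest direct summand of `K` on which `θ'` has a nonzero component; `K` itself is a
  -- candidate.
  obtain ⟨Y, ⟨i, hi, p, hp, hpi, x₀, w₀, hpθ⟩, hYmin⟩ := exists_minimal_measure
    (P := fun Y : G.Representation => ∃ i ∈ homSpace Y K, ∃ p ∈ homSpace K Y,
      (∀ x w, p x (i x w) = w) ∧ ∃ x w, p x (θ' x w) ≠ 0) totalDim
    ⟨K, Family.id K, id_mem_homSpace K, Family.id K, id_mem_homSpace K, fun _ _ => rfl, by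
      by_contra! hcon
      refine hθ0 (funext fun x => LinearMap.ext fun w => ?_)
      exact congrArg Subtype.val (hcon x w)⟩
  have hYK : Y.totalDim ≤ K.totalDim := Finset.sum_le_sum fun x _ =>
    LinearMap.finrank_le_finrank_of_injective (f := i x)
      (Function.LeftInverse.injective (hpi x))
  have hY0 : Y.dim ≠ 0 := fun h => hpθ ((dim_eq_zero_iff Y).1 h _ _)
  refine ⟨Y, ⟨hY0, ?_⟩, hYK.trans_lt hKX, fun hsurj => ?_⟩
  · rintro ⟨B, C, hB, hC, hYBC⟩
    have htot := hYBC.totalDim_eq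
    rw [totalDim_directSum] at htot
    obtain ⟨F, hF, hFb⟩ := isomorphic_iff.1 hYBC
    obtain ⟨F', hF', hFF', hF'F⟩ := exists_inverse hF hFb
    -- A summand of `Y` is again a summand of `K`. If `Y` were decomposable, `θ'` would have a
    -- nonzero component in one of the two parts, which is too small.
    have hcomp : ∀ Z : G.Representation, ∀ j ∈ homSpace Z (B.directSum C),
        ∀ r ∈ homSpace (B.directSum C) Z, (∀ x w, r x (j x w) = w) →
        r x₀ (F x₀ (p x₀ (θ' x₀ w₀))) ≠ 0 → Y.totalDim ≤ Z.totalDim :=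
      fun Z j hj r hr hrj hne => hYmin Z ⟨(i.comp F').comp j,
        comp_mem_homSpace (comp_mem_homSpace hi hF') hj, r.comp (F.comp p),
        comp_mem_homSpace hr (comp_mem_homSpace hF hp), fun x w => by
          simp only [Family.comp_apply, hpi, hF'F, hrj], x₀, w₀, hne⟩
    have hne : F x₀ (p x₀ (θ' x₀ w₀)) ≠ 0 := fun h => hpθ ((hFb x₀).1 (by rw [h, map_zero]))
    by_cases hfst : fst B C x₀ (F x₀ (p x₀ (θ' x₀ w₀))) = 0
    · have := hcomp C _ (inr_mem_homSpace B C) _ (snd_mem_homSpace B C) (fun _ _ => rfl)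
        fun h => hne (Prod.ext hfst h)
      have := totalDim_pos hB
      omega
    · have := hcomp B _ (inl_mem_homSpace B C) _ (fst_mem_homSpace B C) (fun _ _ => rfl) hfst
      have := totalDim_pos hC
      omega
  · have hκ : p.comp θ' ∈ homSpace X Y := comp_mem_homSpace hp hθ'
    -- the kernel of `p.comp θ'` is that of `θ`
    have hker : ∀ x w, p x (θ' x w) = 0 → θ x w = 0 := by
      intro x w hw
      have hmem : (ι.comp i).comp (p.comp θ') ∈ homSpace X X :=
        comp_mem_homSpace (comp_mem_homSpace hι hi) hκ
      have hne : (ι.comp i).comp (p.comp θ') ≠ 0 := by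
        intro h
        have h1 := LinearMap.congr_fun (congrFun h x₀) w₀
        have h2 := hιinj _ _ h1
        rw [Family.comp_apply] at h2
        exact hpθ (by rw [← hpi x₀ (p x₀ (θ' x₀ w₀)), h2, map_zero])
      -- The composite X → K → Y → K → X is a nonzero endomorphism, so its rank is at least that of
      -- `θ`; no kernel is gained after `θ'`.
      have hle := hmin _ ⟨hmem, hne⟩
      have hrank : θ'.rank = θ.rank := by
        refine le_antisymm ?_ (rank_comp_le ι θ')
        refine Finset.sum_le_sum fun x _ => ?_
        have h1 := LinearMap.finrank_range_add_finrank_ker (θ' x)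
        have h2 := LinearMap.finrank_range_add_finrank_ker (θ x)
        have h3 : LinearMap.ker (θ' x) = LinearMap.ker (θ x) := LinearMap.ker_codRestrict _ _ _
        rw [h3] at h1
        omega
      have := eq_zero_of_rank_comp_eq (f := θ') (g := (ι.comp i).comp p)
        (le_trans (le_trans (le_of_eq hrank) hle) (le_of_eq rfl)) x w
        (by rw [Family.comp_apply, hw, map_zero])
      rw [← hιθ, this, map_zero]
    -- `q` extends `p` to `X` as linear mappings only. Its defect vanishes on `K`, which contains
    -- the kernel of `p.comp θ'`, so it factors through `p.comp θ'`; a preimage `f` of the factor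
    -- under `defect Y Y` corrects `q` to a morphism `r` that still equals `p` on `K`.
    -- Homologically, X/K embeds in Y, so Ext(X/K, Y) is a quotient of Ext(Y, Y) = 0.
    choose q hq using fun x => LinearMap.exists_extend (p x)
    have hq' : ∀ x (w : X.space x) (hw : θ x w = 0), q x w = p x ⟨w, hw⟩ := fun x w hw =>
      LinearMap.congr_fun (hq x) ⟨w, hw⟩
    have hfac : ∀ a, ∃ k : Y.space (G.src a) →ₛₗ[G.twist a] Y.space (G.tgt a),
        ∀ w, k (p.comp θ' (G.src a) w) = defect X Y q a w := by
      refine fun a => exists_semilinear_factor _ _ fun w hw => ?_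
      have hw0 := hker _ _ hw
      have hw1 : θ (G.tgt a) (X.map a w) = 0 := by
        rw [← mem_homSpace.1 hθ, hw0, map_zero]
      rw [defect_apply, hq' _ _ hw0, hq' _ _ hw1, sub_eq_zero]
      exact mem_homSpace.1 hp a ⟨w, hw0⟩
    choose k hk using hfac
    obtain ⟨f, hf⟩ := hsurj k
    let r : Family X Y := q - f.comp (p.comp θ')
    have hr : r ∈ homSpace X Y := by
      refine mem_homSpace.2 fun a w => ?_
      have h1 := hk a w
      rw [← hf, defect_apply, defect_apply, mem_homSpace.1 hκ] at h1
      change Y.map a (q _ w - f _ (p.comp θ' _ w)) = q _ (X.map a w) - f _ (p.comp θ' _ (X.map a w))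
      rw [map_sub]
      exact sub_eq_sub_iff_sub_eq_sub.1 h1.symm
    have hrK : ∀ x w, r x (ι x w) = p x w := by
      intro x w
      have h1 : θ x (ι x w) = 0 := w.2
      have h2 : θ' x (ι x w) = 0 := hιinj _ _ h1
      change q x (ι x w) - f x (p x (θ' x (ι x w))) = p x w
      rw [h2, map_zero, map_zero, sub_zero]
      exact hq' _ _ h1
    -- Now `Y` is a nonzero direct summand of `X`, hence all of it, although its total dimension is
    -- smaller.
    have hb := hX.bijective_of_retract hY0 (comp_mem_homSpace hι hi) hr
      fun x w => by rw [Family.comp_apply, hrK, hpi]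
    have := Isomorphic.totalDim_eq (isomorphic_iff.2 ⟨_, comp_mem_homSpace hι hi, hb⟩)
    omega

end Ringel

end Representation

end Biquiver

/-! ### Endomorphisms of indecomposables under a positive definite Tits form -/

namespace Biquiver

universe u v

variable {V : Type u} {E : Type v} {G : Biquiver V E}

/-- The identity or the complex conjugation. -/
noncomputable def conjIf (b : Bool) : ℂ →+* ℂ := if b then starRingEnd ℂ else RingHom.id ℂ

@[simp] theorem conjIf_conjIf (b : Bool) (c : ℂ) : conjIf b (conjIf b c) = c := by
  cases b <;> simp [conjIf]

@[simp] theorem conjIf_ofReal (b : Bool) (r : ℝ) : conjIf b (r : ℂ) = r := by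
  cases b <;> simp [conjIf]

/-- Conjugating the spaces at the vertices with `ε x = true` makes all arrows full. -/
def IsUntwisting (G : Biquiver V E) (ε : V → Bool) : Prop :=
  ∀ a, G.dashed a = xor (ε (G.src a)) (ε (G.tgt a))

/-- This is what makes a complex number, conjugated at the vertices marked by `ε`, commute with all
arrow mappings. -/
theorem IsUntwisting.twist_conjIf {ε : V → Bool} (h : G.IsUntwisting ε) (a : E) (c : ℂ) :
    G.twist a (conjIf (ε (G.src a)) c) = conjIf (ε (G.tgt a)) c := by
  have := h a
  unfold twist conjIf
  rw [this]
  cases ε (G.src a) <;> cases ε (G.tgt a) <;> simp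

namespace Representation

variable {A B C D X Y : G.Representation}

/-- The scalar endomorphisms, twisted by conjugations at vertices. -/
noncomputable def scalarEnd {ε : V → Bool} (h : G.IsUntwisting ε) (A : G.Representation) :
    ℂ →ₗ[ℝ] homSpace A A where
  toFun c := ⟨fun x => conjIf (ε x) c • LinearMap.id, mem_homSpace.2 fun a w => by
    simp [LinearMap.map_smulₛₗ, h.twist_conjIf]⟩
  map_add' c d := by
    ext x w; simp [add_smul]
  map_smul' r c := by
    ext x w
    simp [mul_smul]

theorem scalarEnd_apply {ε : V → Bool} (h : G.IsUntwisting ε) (A : G.Representation) (c : ℂ)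
    (x : V) (w : A.space x) : (scalarEnd h A c : Family A A) x w = conjIf (ε x) c • w := rfl

theorem exists_ne_zero (hA : A.dim ≠ 0) : ∃ x, ∃ w : A.space x, w ≠ 0 := by
  by_contra! h
  exact hA ((dim_eq_zero_iff A).2 h)

theorem scalarEnd_injective {ε : V → Bool} (h : G.IsUntwisting ε) (hA : A.dim ≠ 0) :
    Function.Injective (scalarEnd h A) := by
  rw [injective_iff_map_eq_zero]
  intro c hc
  obtain ⟨x, w, hw⟩ := exists_ne_zero hA
  have h1 : conjIf (ε x) c • w = 0 := by rw [← scalarEnd_apply h A, hc]; rfl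
  have h2 := (smul_eq_zero.1 h1).resolve_right hw
  rw [← conjIf_conjIf (ε x) c, h2, map_zero]

/-- Schur's lemma: subtracting from an endomorphism the twisted scalar of an eigenvalue at one
vertex leaves an endomorphism that is not injective there, hence zero. So the endomorphisms are a
copy of ℂ. -/
theorem finrank_end_of_forall_bijective [Fintype V] {ε : V → Bool} (h : G.IsUntwisting ε)
    (hA : A.dim ≠ 0) (hb : ∀ f ∈ homSpace A A, f ≠ 0 → ∀ x, Function.Bijective (f x)) :
    Module.finrank ℝ (homSpace A A) = 2 := by
  have hs : Function.Surjective (scalarEnd h A) := by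
    rintro ⟨f, hf⟩
    obtain ⟨x, w, hw⟩ := exists_ne_zero hA
    have : Nontrivial (A.space x) := ⟨⟨w, 0, hw⟩⟩
    obtain ⟨l, hl⟩ := Module.End.exists_eigenvalue (f x)
    obtain ⟨y, hy⟩ := hl.exists_hasEigenvector
    -- At `x` a twisted scalar acts through the involution `conjIf (ε x)`, so this one acts there as
    -- `l`.
    refine ⟨conjIf (ε x) l, ?_⟩
    by_contra hne
    have hsub : f - (scalarEnd h A (conjIf (ε x) l) : Family A A) ≠ 0 := by
      rw [sub_ne_zero]
      exact fun h => hne (Subtype.ext h.symm)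
    have := (hb _ (Submodule.sub_mem _ hf (Subtype.prop _)) hsub x).1
    refine hy.2 (this ?_)
    change f x y - (scalarEnd h A _ : Family A A) x y = (f - (scalarEnd h A _ : Family A A)) x 0
    rw [scalarEnd_apply, conjIf_conjIf, hy.apply_eq_smul, sub_self, map_zero]
  rw [← (LinearEquiv.ofBijective _ ⟨scalarEnd_injective h hA, hs⟩).finrank_eq,
    Complex.finrank_real_complex]

variable [Fintype V] [Fintype E]

theorem titsForm_dim_pos (hq : G.titsForm.PosDef) (hA : A.dim ≠ 0) :
    1 ≤ eulerForm G A.dim A.dim := by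
  rw [← titsForm_eq_eulerForm]
  refine hq _ fun h => hA (funext fun x => ?_)
  exact Nat.cast_eq_zero.1 (congrFun h x)

/-- If the Tits form is positive definite then each nonzero endomorphism of an indecomposable
representation is bijective. -/
theorem Indecomposable.bijective_of_ne_zero (hq : G.titsForm.PosDef) {ε : V → Bool}
    (h : G.IsUntwisting ε) (hX : X.Indecomposable) :
    ∀ f ∈ homSpace X X, f ≠ 0 → ∀ x, Function.Bijective (f x) := by
  induction hn : X.totalDim using Nat.strong_induction_on generalizing X with
  | _ n ih =>
    by_contra! hcon
    obtain ⟨f, hf, hf0, hfb⟩ := hcon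
    obtain ⟨Y, hY, hlt, hns⟩ := hX.exists_smaller_self_extension hf hf0 (not_forall.2 hfb)
    have h1 := finrank_end_of_forall_bijective h hY.1 (ih _ (hn ▸ hlt) hY rfl)
    have h2 := titsForm_dim_pos hq hY.1
    -- The bounds 2 ≤ 2q(dim Y) ≤ dim End Y = 2 are equalities, so the cokernel vanishes.
    refine hns (surjective_of_euler_eq ?_)
    have h3 := euler_le Y Y
    rw [h1] at h3 ⊢
    push_cast at h3 ⊢
    omega

/-- Positivity gives at least 1, and twice the value is at most dim End X = 2. -/
theorem Indecomposable.eulerForm_eq_one (hq : G.titsForm.PosDef) {ε : V → Bool}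
    (h : G.IsUntwisting ε) (hX : X.Indecomposable) : eulerForm G X.dim X.dim = 1 := by
  have h1 := finrank_end_of_forall_bijective h hX.1 (hX.bijective_of_ne_zero hq h)
  have h2 := titsForm_dim_pos hq hX.1
  have h3 := euler_le X X
  rw [h1] at h3
  push_cast at h3
  omega

theorem Indecomposable.defect_surjective (hq : G.titsForm.PosDef) {ε : V → Bool}
    (h : G.IsUntwisting ε) (hX : X.Indecomposable) : Function.Surjective (defect X X) := by
  have h1 := finrank_end_of_forall_bijective h hX.1 (hX.bijective_of_ne_zero hq h)
  refine surjective_of_euler_eq ?_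
  rw [hX.eulerForm_eq_one hq h, h1]
  rfl

end Representation

end Biquiver

/-! ### Extensions, and an indecomposable for each root -/

namespace Biquiver

universe u v

variable {V : Type u} {E : Type v} {G : Biquiver V E}

theorem finrank_le_of_ker_le_range {U W T : Type*} [AddCommGroup U] [AddCommGroup W]
    [AddCommGroup T] [Module ℝ U] [Module ℝ W] [Module ℝ T] [Module.Finite ℝ U]
    [Module.Finite ℝ W] [Module.Finite ℝ T] (i : U →ₗ[ℝ] W) (p : W →ₗ[ℝ] T)
    (h : LinearMap.ker p ≤ LinearMap.range i) :
    Module.finrank ℝ W ≤ Module.finrank ℝ U + Module.finrank ℝ (LinearMap.range p) := by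
  have h1 := LinearMap.finrank_range_add_finrank_ker p
  have h2 := Submodule.finrank_mono h
  have h3 := LinearMap.finrank_range_le i
  omega

namespace Representation

variable {A B C D M X Y : G.Representation}

/-- Composition with a morphism on the left. -/
noncomputable def postcomp (X : G.Representation) (p : homSpace A B) :
    homSpace X A →ₗ[ℝ] homSpace X B where
  toFun f := ⟨p.1.comp f.1, comp_mem_homSpace p.2 f.2⟩
  map_add' f g := by ext x w; simp
  map_smul' r f := by ext x w; simp [LinearMap.map_smul_of_tower]

/-- Composition with a morphism on the right. -/
noncomputable def precomp (p : homSpace A B) (X : G.Representation) :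
    homSpace B X →ₗ[ℝ] homSpace A X where
  toFun f := ⟨f.1.comp p.1, comp_mem_homSpace f.2 p.2⟩
  map_add' f g := by ext x w; simp
  map_smul' r f := by ext x w; simp

/-- The extension of `B` by `A` given by a family of semilinear mappings. -/
noncomputable def extension (A B : G.Representation) (η : ArrowFamily B A) :
    G.Representation where
  space x := A.space x × B.space x
  map a :=
    { toFun := fun w => (A.map a w.1 + η a w.2, B.map a w.2)
      map_add' := fun w w' => by
        simp only [Prod.fst_add, Prod.snd_add, map_add, Prod.mk_add_mk]
        congr 1
        abel
      map_smul' := fun c w => by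
        simp only [Prod.smul_fst, Prod.smul_snd, LinearMap.map_smulₛₗ, Prod.smul_mk, smul_add] }

theorem dim_extension (η : ArrowFamily B A) : (A.extension B η).dim = A.dim + B.dim :=
  dim_directSum A B

theorem exists_dim_eq (G : Biquiver V E) (z : V → ℕ) : ∃ A : G.Representation, A.dim = z :=
  ⟨{ space := fun x => Fin (z x) → ℂ, map := fun _ => 0 }, funext fun x => by simp [dim]⟩

theorem map_prod_eq_add {P Q R : Type*} [AddCommGroup P] [AddCommGroup Q] [AddCommGroup R]
    [Module ℂ P] [Module ℂ Q] [Module ℂ R] (f : P × Q →ₗ[ℂ] R) (w : P) (w' : Q) :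
    f (w, w') = f (w, 0) + f (0, w') := by
  rw [← map_add, Prod.mk_add_mk, add_zero, zero_add]

variable [Fintype V]

/-- Left exactness of Hom(M, ·) and Hom(·, Z) on 0 → A → M → B → 0 gives the weak inequality. It is
strict because the identity of `A` does not extend to `M` unless the sequence splits, that is,
unless `η` is a defect. -/
theorem finrank_end_extension_lt {η : ArrowFamily B A} (hη : η ∉ LinearMap.range (defect B A)) :
    Module.finrank ℝ (homSpace (A.extension B η) (A.extension B η)) <
      Module.finrank ℝ (homSpace A A) + Module.finrank ℝ (homSpace A B) +
      Module.finrank ℝ (homSpace B A) + Module.finrank ℝ (homSpace B B) := by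
  set M := A.extension B η with hM
  let i : homSpace A M := ⟨fun x => LinearMap.inl ℂ (A.space x) (B.space x),
    mem_homSpace.2 fun a w => Prod.ext
      ((congrArg (A.map a w + ·) (map_zero (η a))).trans (add_zero _)) (map_zero (B.map a))⟩
  let p : homSpace M B := ⟨fun x => LinearMap.snd ℂ (A.space x) (B.space x),
    mem_homSpace.2 fun _ _ => rfl⟩
  have hpost : Module.finrank ℝ (homSpace M M) ≤ Module.finrank ℝ (homSpace M A) +
      Module.finrank ℝ (homSpace M B) := by
    refine (finrank_le_of_ker_le_range (postcomp M i) (postcomp M p) ?_).trans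
      (Nat.add_le_add_left (Submodule.finrank_le _) _)
    rintro ⟨f, hf⟩ hfp
    have h0 : ∀ x w, (f x w).2 = 0 := fun x w =>
      LinearMap.congr_fun (congrFun (congrArg Subtype.val hfp) x) w
    refine ⟨⟨fun x => (LinearMap.fst ℂ (A.space x) (B.space x)).comp (f x),
      mem_homSpace.2 fun a w => ?_⟩, Subtype.ext (funext fun x => LinearMap.ext fun w =>
        Prod.ext rfl (h0 x w).symm)⟩
    have h1 := congrArg Prod.fst (mem_homSpace.1 hf a w)
    have h2 : (M.map a (f (G.src a) w)).1 = A.map a (f (G.src a) w).1 + η a (f (G.src a) w).2 := rfl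
    rw [h2, h0, map_zero, add_zero] at h1
    exact h1
  have hpre : ∀ Z : G.Representation, LinearMap.ker (precomp i Z) ≤
      LinearMap.range (precomp p Z) := by
    rintro Z ⟨f, hf⟩ hfi
    have h0 : ∀ x (w : A.space x), f x (w, (0 : B.space x)) = 0 := fun x w =>
      LinearMap.congr_fun (congrFun (congrArg Subtype.val hfi) x) w
    have h1 : ∀ x (w : A.space x) (w' : B.space x), f x (w, w') = f x (0, w') := fun x w w' =>
      (map_prod_eq_add (f x) w w').trans ((congrArg (· + _) (h0 x w)).trans (zero_add _))
    refine ⟨⟨fun x => (f x).comp (LinearMap.inr ℂ (A.space x) (B.space x)),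
      mem_homSpace.2 fun a w => ?_⟩, Subtype.ext (funext fun x => LinearMap.ext fun w =>
        (h1 x w.1 w.2).symm)⟩
    have h2 := mem_homSpace.1 hf a ((0 : A.space (G.src a)), w)
    exact h2.trans (h1 _ _ _)
  have hB := (finrank_le_of_ker_le_range _ _ (hpre B)).trans
    (Nat.add_le_add_left (Submodule.finrank_le _) _)
  have hA := finrank_le_of_ker_le_range _ _ (hpre A)
  have hlt : Module.finrank ℝ (LinearMap.range (precomp i A)) <
      Module.finrank ℝ (homSpace A A) := by
    refine Submodule.finrank_lt fun htop => ?_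
    obtain ⟨⟨r, hr⟩, hri⟩ := LinearMap.range_eq_top.1 htop ⟨_, id_mem_homSpace A⟩
    have h0 : ∀ x (w : A.space x), r x (w, (0 : B.space x)) = w := fun x w =>
      LinearMap.congr_fun (congrFun (congrArg Subtype.val hri) x) w
    have h1 : ∀ x (w : A.space x) (w' : B.space x), r x (w, w') = w + r x (0, w') := fun x w w' =>
      (map_prod_eq_add (r x) w w').trans (congrArg (· + _) (h0 x w))
    -- The restriction to `B` of a retraction `r` of `M` onto `A` has defect `η`.
    refine hη ⟨fun x => (r x).comp (LinearMap.inr ℂ (A.space x) (B.space x)), ?_⟩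
    funext a
    ext w
    have h2 : A.map a (r (G.src a) ((0 : A.space (G.src a)), w)) =
        r (G.tgt a) (A.map a 0 + η a w, B.map a w) :=
      mem_homSpace.1 hr a ((0 : A.space (G.src a)), w)
    have h3 : A.map a 0 + η a w = η a w := by rw [map_zero, zero_add]
    exact sub_eq_iff_eq_add.2 (h2.trans ((h1 _ _ _).trans (congrArg (· + _) h3)))
  omega

/-- The endomorphisms of a direct sum contain the matrices of morphisms. -/
theorem le_finrank_end_of_isomorphic (h : M.Isomorphic (A.directSum B)) :
    Module.finrank ℝ (homSpace A A) + Module.finrank ℝ (homSpace A B) +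
      Module.finrank ℝ (homSpace B A) + Module.finrank ℝ (homSpace B B) ≤
      Module.finrank ℝ (homSpace M M) := by
  obtain ⟨F, hF, hFb⟩ := isomorphic_iff.1 h
  obtain ⟨F', hF', -, hFF'⟩ := exists_inverse hF hFb
  let iA : homSpace A M := ⟨F'.comp (inl A B), comp_mem_homSpace hF' (inl_mem_homSpace A B)⟩
  let iB : homSpace B M := ⟨F'.comp (inr A B), comp_mem_homSpace hF' (inr_mem_homSpace A B)⟩
  let pA : homSpace M A := ⟨(fst A B).comp F, comp_mem_homSpace (fst_mem_homSpace A B) hF⟩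
  let pB : homSpace M B := ⟨(snd A B).comp F, comp_mem_homSpace (snd_mem_homSpace A B) hF⟩
  have hAA : ∀ x w, pA.1 x (iA.1 x w) = w := fun x w => congrArg Prod.fst (hFF' x (inl A B x w))
  have hAB : ∀ x w, pA.1 x (iB.1 x w) = 0 := fun x w => congrArg Prod.fst (hFF' x (inr A B x w))
  have hBA : ∀ x w, pB.1 x (iA.1 x w) = 0 := fun x w => congrArg Prod.snd (hFF' x (inl A B x w))
  have hBB : ∀ x w, pB.1 x (iB.1 x w) = w := fun x w => congrArg Prod.snd (hFF' x (inr A B x w))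
  let T : (homSpace A A × homSpace A B) × (homSpace B A × homSpace B B) →ₗ[ℝ] homSpace M M :=
    LinearMap.coprod
      (precomp pA M ∘ₗ LinearMap.coprod (postcomp A iA) (postcomp A iB))
      (precomp pB M ∘ₗ LinearMap.coprod (postcomp B iA) (postcomp B iB))
  have hT : Function.Injective T := by
    rw [injective_iff_map_eq_zero]
    rintro ⟨⟨a, b⟩, ⟨c, d⟩⟩ h0
    have h1 : ∀ x w, (iA.1 x (a.1 x (pA.1 x w)) + iB.1 x (b.1 x (pA.1 x w))) +
        (iA.1 x (c.1 x (pB.1 x w)) + iB.1 x (d.1 x (pB.1 x w))) = 0 := fun x w =>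
      LinearMap.congr_fun (congrFun (congrArg Subtype.val h0) x) w
    have ha : a = 0 := Subtype.ext <| funext fun x => LinearMap.ext fun w => by
      have := congrArg (pA.1 x) (h1 x (iA.1 x w))
      simpa only [map_add, hAA, hAB, hBA, hBB, map_zero, add_zero, zero_add, ZeroMemClass.coe_zero,
        Pi.zero_apply, LinearMap.zero_apply] using this
    have hb : b = 0 := Subtype.ext <| funext fun x => LinearMap.ext fun w => by
      have := congrArg (pB.1 x) (h1 x (iA.1 x w))
      simpa only [map_add, hAA, hAB, hBA, hBB, map_zero, add_zero, zero_add, ZeroMemClass.coe_zero,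
        Pi.zero_apply, LinearMap.zero_apply] using this
    have hc : c = 0 := Subtype.ext <| funext fun x => LinearMap.ext fun w => by
      have := congrArg (pA.1 x) (h1 x (iB.1 x w))
      simpa only [map_add, hAA, hAB, hBA, hBB, map_zero, add_zero, zero_add, ZeroMemClass.coe_zero,
        Pi.zero_apply, LinearMap.zero_apply] using this
    have hd : d = 0 := Subtype.ext <| funext fun x => LinearMap.ext fun w => by
      have := congrArg (pB.1 x) (h1 x (iB.1 x w))
      simpa only [map_add, hAA, hAB, hBA, hBB, map_zero, add_zero, zero_add, ZeroMemClass.coe_zero,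
        Pi.zero_apply, LinearMap.zero_apply] using this
    rw [ha, hb, hc, hd]
    rfl
  have := LinearMap.finrank_le_finrank_of_injective hT
  simp only [Module.finrank_prod] at this
  omega

variable [Fintype E]

/-- If the Tits form is positive definite, then a representation with the least number of
endomorphisms whose dimension is a root is indecomposable. -/
theorem exists_indecomposable (hq : G.titsForm.PosDef) {z : V → ℕ} (hz : eulerForm G z z = 1) :
    ∃ A : G.Representation, A.Indecomposable ∧ A.dim = z := by
  obtain ⟨M, hM, hmin⟩ := exists_minimal_measure
    (P := fun A : G.Representation => A.dim = z)
    (fun A => Module.finrank ℝ (homSpace A A)) (exists_dim_eq G z)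
  -- A nonsplit extension of the two summands would have the same dimension as `M` and fewer
  -- endomorphisms.
  have hsurj : ∀ A B : G.Representation, M.Isomorphic (A.directSum B) →
      Function.Surjective (defect A B) ∧ Function.Surjective (defect B A) := by
    intro A B h
    have h1 := le_finrank_end_of_isomorphic h
    have h2 : A.dim + B.dim = z := by rw [← dim_directSum, ← h.dim_eq, hM]
    constructor
    · intro η
      by_contra hη
      have := finrank_end_extension_lt hη
      have := hmin (B.extension A η) (by rw [dim_extension, add_comm, h2])
      omega
    · intro η
      by_contra hη
      have := finrank_end_extension_lt hη
      have := hmin (A.extension B η) (by rw [dim_extension, h2])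
      omega
  refine ⟨M, ⟨fun h0 => ?_, ?_⟩, hM⟩
  · rw [← hM, h0] at hz
    simp [eulerForm] at hz
  · rintro ⟨A, B, hA, hB, h⟩
    obtain ⟨h1, h2⟩ := hsurj A B h
    -- Without extensions both mixed Euler terms are nonnegative, while the diagonal ones are at
    -- least 1; so the value at `z` would be at least 2.
    have h3 := euler_eq_of_surjective h1
    have h4 := euler_eq_of_surjective h2
    have h5 := titsForm_dim_pos hq hA
    have h6 := titsForm_dim_pos hq hB
    have h7 : eulerForm G z z = eulerForm G A.dim A.dim + eulerForm G B.dim B.dim +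
        eulerForm G A.dim B.dim + eulerForm G B.dim A.dim := by
      rw [← hM, h.dim_eq, dim_directSum]
      simp only [eulerForm, Pi.add_apply, Nat.cast_add, add_mul, mul_add, Finset.sum_add_distrib]
      ring
    omega

end Representation

end Biquiver

/-! ### Representations without self-extensions, and uniqueness -/

namespace Biquiver

universe u v

variable {V : Type u} {E : Type v} {G : Biquiver V E}

/-- The polynomial functions on the real line. -/
noncomputable def polyFun : Subalgebra ℝ (ℝ → ℝ) :=
  (Polynomial.aeval (R := ℝ) (id : ℝ → ℝ)).range

theorem mem_polyFun {f : ℝ → ℝ} : f ∈ polyFun ↔ ∃ p : Polynomial ℝ, ∀ t, f t = p.eval t := by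
  have h : ∀ (p : Polynomial ℝ) t, Polynomial.aeval (R := ℝ) (id : ℝ → ℝ) p t = p.eval t := by
    intro p t
    exact (Polynomial.aeval_algHom_apply (Pi.evalAlgHom ℝ (fun _ : ℝ => ℝ) t) id p).symm
  constructor
  · rintro ⟨p, rfl⟩
    exact ⟨p, h p⟩
  · rintro ⟨p, hp⟩
    exact ⟨p, funext fun t => (h p t).trans (hp t).symm⟩

theorem det_mem_polyFun {n : Type*} [Fintype n] [DecidableEq n] {M : ℝ → Matrix n n ℝ}
    (h : ∀ i j, (fun t => M t i j) ∈ polyFun) : (fun t => (M t).det) ∈ polyFun := by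
  have : (fun t => (M t).det) =
      ∑ σ : Equiv.Perm n, Equiv.Perm.sign σ • ∏ i, fun t => M t (σ i) i := by
    funext t
    simp [Matrix.det_apply, Finset.sum_apply, Finset.prod_apply]
  rw [this]
  refine Subalgebra.sum_mem _ fun σ _ => ?_
  rw [Units.smul_def]
  exact zsmul_mem (Subalgebra.prod_mem _ fun i _ => h _ _) _

theorem adjugate_mem_polyFun {n : Type*} [Fintype n] [DecidableEq n] {M : ℝ → Matrix n n ℝ}
    (h : ∀ i j, (fun t => M t i j) ∈ polyFun) (i j : n) :
    (fun t => (M t).adjugate i j) ∈ polyFun := by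
  simp only [Matrix.adjugate_apply]
  refine det_mem_polyFun fun k l => ?_
  simp only [Matrix.updateRow_apply]
  split_ifs
  · exact Subalgebra.algebraMap_mem polyFun ((Pi.single i (1 : ℝ) : n → ℝ) l)
  · exact h k l

/-- If `Ψ` is surjective then each vector of its kernel extends to a polynomial curve in the
kernels of the pencil `Ψ + t Φ`. -/
theorem exists_polynomial_curve {P W : Type*} [AddCommGroup P] [AddCommGroup W] [Module ℝ P]
    [Module ℝ W] [Module.Finite ℝ P] {Ψ : P →ₗ[ℝ] W} (hΨ : Function.Surjective Ψ)
    (Φ : P →ₗ[ℝ] W) {e : P} (he : Ψ e = 0) :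
    ∃ g : ℝ → P, g 0 = e ∧ (∀ t, Ψ (g t) + t • Φ (g t) = 0) ∧
      ∀ l : P →ₗ[ℝ] ℝ, (fun t => l (g t)) ∈ polyFun := by
  obtain ⟨S, hS⟩ := Ψ.exists_rightInverse_of_surjective (LinearMap.range_eq_top.2 hΨ)
  have hS' : ∀ w, Ψ (S w) = w := fun w => LinearMap.congr_fun hS w
  let b := Module.finBasis ℝ P
  let N := LinearMap.toMatrix b b (S ∘ₗ Φ)
  let M : ℝ → Matrix _ _ ℝ := fun t => 1 + t • N
  -- The adjugate replaces the inverse of 1 + tSΦ, so the curve is polynomial and defined for all t: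
  -- it satisfies (1 + tSΦ) g(t) = det · e, and applying `Ψ` kills the right side. At t = 0 the
  -- adjugate is the identity.
  refine ⟨fun t => b.equivFun.symm ((M t).adjugate.mulVec (b.equivFun e)), ?_, fun t => ?_,
    fun l => ?_⟩
  · simp [M]
  · set y := b.equivFun.symm ((M t).adjugate.mulVec (b.equivFun e)) with hy
    have h1 : y + t • S (Φ y) = (M t).det • e := by
      apply b.equivFun.injective
      have h2 : b.equivFun (S (Φ y)) = N.mulVec (b.equivFun y) :=
        (LinearMap.toMatrix_mulVec_repr b b (S ∘ₗ Φ) y).symm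
      have h3 : b.equivFun y = (M t).adjugate.mulVec (b.equivFun e) := by
        rw [hy, LinearEquiv.apply_symm_apply]
      have h4 : (M t).mulVec (b.equivFun y) = (M t).det • b.equivFun e := by
        rw [h3, Matrix.mulVec_mulVec, Matrix.mul_adjugate, Matrix.smul_mulVec, Matrix.one_mulVec]
      rw [map_add, map_smul, map_smul, h2, ← h4]
      simp only [M]
      rw [Matrix.add_mulVec, Matrix.one_mulVec, Matrix.smul_mulVec]
    have h5 := congrArg Ψ h1
    rwa [map_add, map_smul, map_smul, hS', he, smul_zero] at h5
  · have : (fun t => l (b.equivFun.symm ((M t).adjugate.mulVec (b.equivFun e)))) =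
        ∑ i, (∑ j, (fun t => (M t).adjugate i j) * algebraMap ℝ (ℝ → ℝ) (b.equivFun e j)) *
          algebraMap ℝ (ℝ → ℝ) (l (b i)) := by
      funext t
      simp [Module.Basis.equivFun_symm_apply, Matrix.mulVec, dotProduct, Finset.sum_apply,
        Pi.algebraMap_apply]
    rw [this]
    refine Subalgebra.sum_mem _ fun i _ => Subalgebra.mul_mem _
      (Subalgebra.sum_mem _ fun j _ => Subalgebra.mul_mem _ ?_ (Subalgebra.algebraMap_mem _ _))
      (Subalgebra.algebraMap_mem _ _)
    refine adjugate_mem_polyFun (fun k l => ?_) i j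
    have : (fun t => M t k l) = algebraMap ℝ (ℝ → ℝ) ((1 : Matrix _ _ ℝ) k l) +
        id * algebraMap ℝ (ℝ → ℝ) (N k l) := by
      funext t; simp [M, Pi.algebraMap_apply]
    rw [this]
    exact Subalgebra.add_mem _ (Subalgebra.algebraMap_mem _ _) (Subalgebra.mul_mem _
      (mem_polyFun.2 ⟨Polynomial.X, fun t => by simp⟩) (Subalgebra.algebraMap_mem _ _))

namespace Representation

variable {A B C D M X Y : G.Representation}

/-- The representation on the same spaces with other mappings. -/
noncomputable def withMap (A : G.Representation) (m : ArrowFamily A A) : G.Representation where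
  space := A.space
  map := m

variable [Fintype V]

/-- If `A` has no self-extensions then almost all representations of a line through `A` are
isomorphic to `A`. -/
theorem exists_polynomial_isomorphic (h : Function.Surjective (defect A A))
    (n : ArrowFamily A A) :
    ∃ p : Polynomial ℝ, p ≠ 0 ∧
      ∀ t, p.eval t ≠ 0 → A.Isomorphic (A.withMap (A.map + t • n)) := by
  classical
  -- A family `f` is a morphism from `A` to the point `A.map + t • n` exactly when `defect A A f + t
  -- • Φ f = 0`.
  let Φ : Family A A →ₗ[ℝ] ArrowFamily A A :=
    { toFun := fun f a => (n a).comp (f (G.src a))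
      map_add' := fun f g => by funext a; ext w; simp
      map_smul' := fun r f => by funext a; ext w; simp [map_real_smul] }
  obtain ⟨g, hg0, hg, hpoly⟩ := exists_polynomial_curve h Φ (id_mem_homSpace A)
  have hhom : ∀ t, g t ∈ homSpace A (A.withMap (A.map + t • n)) := by
    intro t
    refine mem_homSpace.2 fun a w => ?_
    have h1 := LinearMap.congr_fun (congrFun (hg t) a) w
    have h2 : A.map a (g t _ w) - g t _ (A.map a w) + t • n a (g t _ w) = 0 := h1
    have h3 : A.map a (g t _ w) + t • n a (g t _ w) = g t _ (A.map a w) := by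
      rw [← sub_eq_zero, ← h2]; abel
    exact h3
  let bas := fun x => Module.finBasis ℝ (A.space x)
  let mat : ∀ x, Family A A → Matrix _ _ ℝ := fun x f =>
    LinearMap.toMatrix (bas x) (bas x) ((f x).restrictScalars ℝ)
  have hmat : ∀ x, (fun t => (mat x (g t)).det) ∈ polyFun := by
    intro x
    refine det_mem_polyFun fun i j => ?_
    have := hpoly
      { toFun := fun f => (bas x).repr (f x (bas x j)) i
        map_add' := fun f g => by simp
        map_smul' := fun r f => by simp }
    simpa [mat, LinearMap.toMatrix_apply] using this
  -- The product over the vertices of the determinants of the curve detects bijectivity; it is 1 at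
  -- t = 0, where the curve passes through the identity.
  obtain ⟨p, hp⟩ := mem_polyFun.1 (Subalgebra.prod_mem polyFun fun x (_ : x ∈ Finset.univ) => hmat x)
  simp only [Finset.prod_apply] at hp
  refine ⟨p, ?_, fun t ht => isomorphic_iff.2 ⟨g t, hhom t, fun x => ?_⟩⟩
  · rintro rfl
    have h0 := hp 0
    rw [hg0, Polynomial.eval_zero, Finset.prod_eq_zero_iff] at h0
    obtain ⟨x, -, hx⟩ := h0
    have : mat x (Family.id A) = 1 := LinearMap.toMatrix_id (bas x)
    rw [this, Matrix.det_one] at hx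
    exact one_ne_zero hx
  · rw [← hp, Finset.prod_ne_zero_iff] at ht
    have hdet := ht x (Finset.mem_univ x)
    simp only [mat, LinearMap.det_toMatrix] at hdet
    have hinj : Function.Injective ((g t x).restrictScalars ℝ) := by
      by_contra hni
      exact hdet (LinearMap.det_eq_zero_iff_ker_ne_bot.2 (LinearMap.ker_eq_bot.not.2 hni))
    replace hinj : Function.Injective (g t x) := hinj
    exact ⟨hinj, LinearMap.injective_iff_surjective.1 hinj⟩

variable [Fintype E]

/-- If the Tits form is positive definite then an indecomposable representation is determined by
its dimension. -/
theorem Indecomposable.isomorphic_of_dim_eq (hq : G.titsForm.PosDef) {ε : V → Bool}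
    (hε : G.IsUntwisting ε) (hA : A.Indecomposable) (hB : B.Indecomposable) (h : A.dim = B.dim) :
    A.Isomorphic B := by
  let e : ∀ x, A.space x ≃ₗ[ℂ] B.space x := fun x => LinearEquiv.ofFinrankEq _ _ (congrFun h x)
  -- `B` is transported to the spaces of `A`, so that a line can be drawn between the two.
  let m : ArrowFamily A A := fun a =>
    ((e (G.tgt a)).symm : _ →ₗ[ℂ] _).comp ((B.map a).comp (e (G.src a) : _ →ₗ[ℂ] _))
  have hBm : (A.withMap m).Isomorphic B :=
    isomorphic_iff.2 ⟨fun x => (e x : A.space x →ₗ[ℂ] B.space x), mem_homSpace.2 fun a w =>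
      ((e (G.tgt a)).apply_symm_apply _).symm, fun x => (e x).bijective⟩
  have hm : (A.withMap m).Indecomposable := hB.of_isomorphic hBm.symm
  obtain ⟨p, hp0, hp⟩ := exists_polynomial_isomorphic (hA.defect_surjective hq hε) (m - A.map)
  obtain ⟨r, hr0, hr⟩ := exists_polynomial_isomorphic (hm.defect_surjective hq hε) (A.map - m)
  have hr1 : r.comp (1 - Polynomial.X) ≠ 0 := by
    intro h0
    have := congrArg (Polynomial.comp · (1 - Polynomial.X)) h0
    simp only [Polynomial.comp_assoc, Polynomial.sub_comp, Polynomial.one_comp,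
      Polynomial.X_comp, sub_sub_cancel, Polynomial.comp_X, Polynomial.zero_comp] at this
    exact hr0 this
  -- The parameter t from `A` is 1 − t from `B`; a common nonroot gives a point of the line
  -- isomorphic to both.
  obtain ⟨t, ht⟩ : ∃ t, (p * r.comp (1 - Polynomial.X)).eval t ≠ 0 := by
    by_contra! h0
    exact mul_ne_zero hp0 hr1 (Polynomial.funext fun t => by rw [h0, Polynomial.eval_zero])
  rw [Polynomial.eval_mul, Polynomial.eval_comp] at ht
  have h1 := hp t (left_ne_zero_of_mul ht)
  have h2 := hr (1 - t) (by simpa using right_ne_zero_of_mul ht)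
  have h3 : A.map + t • (m - A.map) = m + (1 - t) • (A.map - m) := by
    funext a
    ext w
    simp only [Pi.add_apply, Pi.smul_apply, Pi.sub_apply, LinearMap.add_apply,
      LinearMap.smul_apply, LinearMap.sub_apply, sub_smul, one_smul, smul_sub]
    abel
  rw [h3] at h1
  exact h1.trans (h2.symm.trans hBm)

end Representation

end Biquiver

/-! ### Connected sets, untwisting and finiteness for a positive definite Tits form -/

namespace Biquiver

universe u v

variable {V : Type u} {E : Type v} {G : Biquiver V E}

/-- The arrow `a` joins the vertex `x` with a vertex in `S`. -/
def Joins (G : Biquiver V E) (a : E) (S : Finset V) (x : V) : Prop :=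
  (G.src a ∈ S ∧ G.tgt a = x) ∨ (G.src a = x ∧ G.tgt a ∈ S)

theorem adj_iff {x y : V} : G.toSimpleGraph.Adj x y ↔
    x ≠ y ∧ ∃ a, (G.src a = x ∧ G.tgt a = y) ∨ (G.src a = y ∧ G.tgt a = x) := by
  rw [toSimpleGraph, SimpleGraph.fromRel_adj, exists_or]

theorem exists_joins_of_adj {S : Finset V} {x y : V} (h : G.toSimpleGraph.Adj x y) (hx : x ∈ S) :
    ∃ a, G.Joins a S y := by
  obtain ⟨-, a, ⟨rfl, rfl⟩ | ⟨rfl, rfl⟩⟩ := adj_iff.1 h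
  · exact ⟨a, Or.inl ⟨hx, rfl⟩⟩
  · exact ⟨a, Or.inr ⟨rfl, hx⟩⟩

theorem Connected.exists_adj (hG : G.Connected) {S : Finset V} (h : S.Nonempty)
    {y : V} (hy : y ∉ S) : ∃ x z, x ∈ S ∧ z ∉ S ∧ G.toSimpleGraph.Adj x z := by
  obtain ⟨x, hx⟩ := h
  obtain ⟨p⟩ := hG.preconnected x y
  obtain ⟨d, -, h1, h2⟩ := p.exists_boundary_dart (S : Set V) hx hy
  exact ⟨d.fst, d.snd, h1, h2, d.adj⟩

section Indicator

variable [DecidableEq V]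

theorem single_one_nonneg (x y : V) : (0 : ℤ) ≤ (Pi.single x 1 : V → ℤ) y := by
  rw [Pi.single_apply]; split_ifs <;> simp

/-- The indicator vector of a set of vertices. -/
def indicator (S : Finset V) : V → ℤ := fun x => if x ∈ S then 1 else 0

theorem indicator_insert {S : Finset V} {x : V} (h : x ∉ S) :
    indicator (insert x S) = indicator S + Pi.single x 1 := by
  funext y
  by_cases hy : y = x
  · subst hy; simp [indicator, h]
  · simp [indicator, hy]

theorem indicator_singleton (x : V) : indicator {x} = Pi.single x 1 := by
  funext y
  simp [indicator, Pi.single_apply]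

theorem indicator_ne_zero {S : Finset V} (h : S.Nonempty) : indicator S ≠ 0 := by
  obtain ⟨x, hx⟩ := h
  intro h0
  simpa [indicator, hx] using congrFun h0 x

end Indicator

variable [Fintype V] [Fintype E]

theorem polar_titsForm (G : Biquiver V E) (y z : V → ℤ) :
    QuadraticMap.polar G.titsForm y z =
      2 * ∑ x, y x * z x - ∑ a, (y (G.src a) * z (G.tgt a) + z (G.src a) * y (G.tgt a)) := by
  have h1 : ∑ x, (y x + z x) ^ 2 = ∑ x, y x ^ 2 + ∑ x, z x ^ 2 + 2 * ∑ x, y x * z x := by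
    rw [Finset.mul_sum, ← Finset.sum_add_distrib, ← Finset.sum_add_distrib]
    exact Finset.sum_congr rfl fun x _ => by ring
  have h2 : ∑ a, (y (G.src a) + z (G.src a)) * (y (G.tgt a) + z (G.tgt a)) =
      ∑ a, y (G.src a) * y (G.tgt a) + ∑ a, z (G.src a) * z (G.tgt a) +
        ∑ a, (y (G.src a) * z (G.tgt a) + z (G.src a) * y (G.tgt a)) := by
    rw [← Finset.sum_add_distrib, ← Finset.sum_add_distrib]
    exact Finset.sum_congr rfl fun x _ => by ring
  rw [QuadraticMap.polar, titsForm_apply, titsForm_apply, titsForm_apply]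
  simp only [Pi.add_apply]
  rw [h1, h2]
  ring

theorem titsForm_nonneg (hq : G.titsForm.PosDef) (z : V → ℤ) : 0 ≤ G.titsForm z := by
  by_cases h : z = 0
  · rw [h, QuadraticMap.map_zero]
  · exact (hq z h).le

section Joining

variable [DecidableEq V]

theorem titsForm_single_le (G : Biquiver V E) (x : V) : G.titsForm (Pi.single x 1) ≤ 1 := by
  rw [titsForm_apply]
  have h1 : ∑ y, (Pi.single x 1 : V → ℤ) y ^ 2 = 1 := by
    simp [Pi.single_apply]
  have h2 : 0 ≤ ∑ a, (Pi.single x 1 : V → ℤ) (G.src a) * (Pi.single x 1 : V → ℤ) (G.tgt a) :=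
    Finset.sum_nonneg fun a _ => mul_nonneg (single_one_nonneg _ _)
      (single_one_nonneg _ _)
  omega

/-- A loop would make the form nonpositive on the unit vector of its vertex. -/
theorem src_ne_tgt (hq : G.titsForm.PosDef) (a : E) : G.src a ≠ G.tgt a := by
  intro h
  have h0 := hq (Pi.single (G.src a) 1) (by simp)
  rw [titsForm_apply] at h0
  have h1 : ∑ y, (Pi.single (G.src a) 1 : V → ℤ) y ^ 2 = 1 := by
    simp [Pi.single_apply]
  have h2 := Finset.single_le_sum (f := fun b => (Pi.single (G.src a) 1 : V → ℤ) (G.src b) *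
    (Pi.single (G.src a) 1 : V → ℤ) (G.tgt b)) (fun b _ =>
      mul_nonneg (single_one_nonneg _ _) (single_one_nonneg _ _))
    (Finset.mem_univ a)
  simp only [← h, Pi.single_eq_same] at h2
  omega

/-- As `x ∉ S`, the diagonal part of the polar form vanishes; no arrow contributes positively, and
each arrow of `F` contributes at most −1. -/
theorem polar_indicator_le {S : Finset V} {x : V} (hx : x ∉ S) (F : Finset E)
    (hF : ∀ a ∈ F, G.Joins a S x) :
    QuadraticMap.polar G.titsForm (indicator S) (Pi.single x 1) ≤ -(F.card : ℤ) := by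
  rw [polar_titsForm]
  have h1 : ∑ y, indicator S y * (Pi.single x 1 : V → ℤ) y = 0 := by
    simp [Pi.single_apply, indicator, hx]
  have hn : ∀ a, 0 ≤ indicator S (G.src a) * (Pi.single x 1 : V → ℤ) (G.tgt a) +
      (Pi.single x 1 : V → ℤ) (G.src a) * indicator S (G.tgt a) := by
    intro a
    have h0 : ∀ y, 0 ≤ indicator S y := fun y => by unfold indicator; split_ifs <;> simp
    have h0' : ∀ y, 0 ≤ (Pi.single x 1 : V → ℤ) y := single_one_nonneg _
    exact add_nonneg (mul_nonneg (h0 _) (h0' _)) (mul_nonneg (h0' _) (h0 _))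
  have h2 : (F.card : ℤ) ≤ ∑ a ∈ F, (indicator S (G.src a) * (Pi.single x 1 : V → ℤ) (G.tgt a) +
      (Pi.single x 1 : V → ℤ) (G.src a) * indicator S (G.tgt a)) := by
    rw [Finset.cast_card]
    refine Finset.sum_le_sum fun a ha => ?_
    rcases hF a ha with ⟨h, rfl⟩ | ⟨rfl, h⟩
    · have : G.src a ≠ G.tgt a := fun h' => hx (h' ▸ h)
      simp [indicator, h, this]
    · have : G.tgt a ≠ G.src a := fun h' => hx (h' ▸ h)
      simp [indicator, h, this]
  have h3 := Finset.sum_le_sum_of_subset_of_nonneg (Finset.subset_univ F)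
    fun a _ _ => hn a
  rw [h1]
  linarith

theorem titsForm_insert_le {S : Finset V} {x : V} (hx : x ∉ S) (F : Finset E)
    (hF : ∀ a ∈ F, G.Joins a S x) :
    G.titsForm (indicator (insert x S)) ≤ G.titsForm (indicator S) + 1 - F.card := by
  rw [indicator_insert hx, QuadraticMap.map_add G.titsForm]
  have := polar_indicator_le hx F hF
  have := titsForm_single_le G x
  linarith

/-- The bound 1 on the indicator stands in for connectedness: it holds for a single vertex and
survives adding a neighbour. -/
theorem titsForm_insert_le_one {S : Finset V} (hS : G.titsForm (indicator S) ≤ 1) {x : V}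
    (hx : x ∉ S) {a : E} (ha : G.Joins a S x) : G.titsForm (indicator (insert x S)) ≤ 1 := by
  have := titsForm_insert_le hx {a} (by simpa using ha)
  simp only [Finset.card_singleton, Nat.cast_one] at this
  omega

/-- If the Tits form is positive definite then a vertex is joined with a connected set by at most
one arrow. -/
theorem eq_of_joins (hq : G.titsForm.PosDef) {S : Finset V} (hS : G.titsForm (indicator S) ≤ 1)
    {x : V} (hx : x ∉ S) {a b : E} (ha : G.Joins a S x) (hb : G.Joins b S x) : a = b := by
  classical
  by_contra hab
  -- Two joining arrows would close a cycle and bring the form down to 0 or less.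
  have h1 := titsForm_insert_le (G := G) hx {a, b} (by simp [ha, hb])
  rw [Finset.card_pair hab] at h1
  have h2 := hq _ (indicator_ne_zero (S := insert x S) ⟨x, Finset.mem_insert_self _ _⟩)
  push_cast at h1
  omega

end Joining

/-- The graph is a tree without multiple arrows. Growing a set vertex by vertex, each new vertex
meets the old ones in exactly one arrow, which imposes one condition on `ε` and can be satisfied by
its new value. -/
theorem exists_isUntwisting (hG : G.Connected) (hq : G.titsForm.PosDef) :
    ∃ ε, G.IsUntwisting ε := by
  classical
  have key : ∀ k < Fintype.card V, ∃ S : Finset V, S.card = k + 1 ∧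
      G.titsForm (indicator S) ≤ 1 ∧ ∃ ε : V → Bool, ∀ a, G.src a ∈ S → G.tgt a ∈ S →
        G.dashed a = xor (ε (G.src a)) (ε (G.tgt a)) := by
    intro k hk
    induction k with
    | zero =>
      obtain ⟨x⟩ := hG.nonempty
      refine ⟨{x}, rfl, ?_, fun _ => false, fun a h1 h2 => ?_⟩
      · rw [indicator_singleton]; exact titsForm_single_le G x
      · rw [Finset.mem_singleton] at h1 h2
        exact (src_ne_tgt hq a (h1.trans h2.symm)).elim
    | succ k ih =>
      obtain ⟨S, hc, hS, ε, hε⟩ := ih (by omega)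
      obtain ⟨y, hy⟩ : ∃ y, y ∉ S := by
        by_contra! h
        have := (Finset.card_eq_iff_eq_univ S).2 (Finset.eq_univ_iff_forall.2 h)
        omega
      obtain ⟨x, z, hx, hz, hxz⟩ := hG.exists_adj (Finset.card_pos.1 (by omega)) hy
      obtain ⟨b, hb⟩ := exists_joins_of_adj hxz hx
      refine ⟨insert z S, by rw [Finset.card_insert_of_notMem hz, hc],
        titsForm_insert_le_one hS hz hb, Function.update ε z
          (xor (G.dashed b) (if G.src b = z then ε (G.tgt b) else ε (G.src b))), fun a h1 h2 => ?_⟩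
      rw [Finset.mem_insert] at h1 h2
      have hne := src_ne_tgt hq a
      rcases h1 with h1 | h1
      · have h2 := h2.resolve_left (fun h => hne (h1.trans h.symm))
        obtain rfl : a = b := eq_of_joins hq hS hz (Or.inr ⟨h1, h2⟩) hb
        have h3 : G.tgt a ≠ z := fun h => hz (h ▸ h2)
        rw [Function.update_of_ne h3, if_pos h1, h1, Function.update_self]
        simp
      · have h3 : G.src a ≠ z := fun h => hz (h ▸ h1)
        rcases h2 with h2 | h2
        · obtain rfl : a = b := eq_of_joins hq hS hz (Or.inl ⟨h1, h2⟩) hb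
          rw [Function.update_of_ne h3, if_neg h3, h2, Function.update_self]
          cases G.dashed a <;> cases ε (G.src a) <;> rfl
        · have h4 : G.tgt a ≠ z := fun h => hz (h ▸ h2)
          rw [Function.update_of_ne h3, Function.update_of_ne h4]
          exact hε a h1 h2
  have hpos : 0 < Fintype.card V := Fintype.card_pos_iff.2 hG.nonempty
  obtain ⟨S, hc, -, ε, hε⟩ := key (Fintype.card V - 1) (by omega)
  have hu : S = Finset.univ := (Finset.card_eq_iff_eq_univ S).1 (by omega)
  exact ⟨ε, fun a => hε a (by simp [hu]) (by simp [hu])⟩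

/-- For a root z, nonnegativity at z ± e_x bounds the polar value of z with e_x by 2 in absolute
value. These values determine z, because a vector polar to everything has form 0. -/
theorem finite_roots (hq : G.titsForm.PosDef) : {z : V → ℤ | G.titsForm z = 1}.Finite := by
  classical
  let c : (V → ℤ) → V → ℤ := fun z x => QuadraticMap.polar G.titsForm z (Pi.single x 1)
  refine Set.Finite.of_injOn (f := c) (t := Set.pi Set.univ fun _ => Set.Icc (-2) 2) ?_ ?_
    (Set.Finite.pi fun _ => Set.finite_Icc _ _)
  · intro z hz x _
    have h1 := titsForm_nonneg hq (z + Pi.single x 1)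
    have h2 := titsForm_nonneg hq (z + -Pi.single x 1)
    have h3 := titsForm_single_le G x
    rw [QuadraticMap.map_add G.titsForm] at h1 h2
    rw [QuadraticMap.polar_neg_right, QuadraticMap.map_neg] at h2
    have hz' : G.titsForm z = 1 := hz
    change -2 ≤ QuadraticMap.polar _ _ _ ∧ QuadraticMap.polar _ _ _ ≤ 2
    omega
  · intro y _ z _ h
    have h1 : ∀ w : V → ℤ, G.titsForm.polarBilin (y - z) w = 0 := by
      intro w
      have : G.titsForm.polarBilin (y - z) = 0 := by
        refine LinearMap.pi_ext' fun x => LinearMap.ext_ring ?_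
        have := congrFun h x
        simp only [c] at this
        simp [this]
      rw [this]; rfl
    have h2 : 2 * G.titsForm (y - z) = 0 := by
      have := h1 (y - z)
      rw [QuadraticMap.polarBilin_apply_apply, QuadraticMap.polar_self] at this
      simpa using this
    by_contra hne
    have := hq (y - z) (sub_ne_zero.2 hne)
    omega

theorem representationFinite_of_posDef (hG : G.Connected) (hq : G.titsForm.PosDef) :
    G.RepresentationFinite := by
  classical
  obtain ⟨ε, hε⟩ := exists_isUntwisting hG hq
  have hfin : {z : V → ℕ | Representation.eulerForm G z z = 1}.Finite := by
    refine Set.Finite.of_injOn (f := fun (z : V → ℕ) x => (z x : ℤ)) (fun z hz => ?_) ?_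
      (finite_roots hq)
    · exact (Representation.titsForm_eq_eulerForm z).trans hz
    · intro y _ z _ h
      funext x
      exact Nat.cast_injective (congrFun h x)
  choose R hR using fun z : {z : V → ℕ | Representation.eulerForm G z z = 1} =>
    Representation.exists_indecomposable hq z.2
  have : Finite {z : V → ℕ | Representation.eulerForm G z z = 1} := hfin
  refine ⟨Set.range R, Set.finite_range R, fun A hA => ?_⟩
  refine ⟨_, ⟨⟨A.dim, hA.eulerForm_eq_one hq hε⟩, rfl⟩, ?_⟩
  exact hA.isomorphic_of_dim_eq hq hε (hR ⟨A.dim, _⟩).1 (hR ⟨A.dim, _⟩).2.symm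

end Biquiver

/-! ### Representation-finite implies positive definite: a dimension count -/

namespace Biquiver

universe u v

variable {V : Type u} {E : Type v} {G : Biquiver V E}

namespace Representation

variable {A B C D : G.Representation}

theorem Isomorphic.directSum (h : A.Isomorphic B) (h' : C.Isomorphic D) :
    (A.directSum C).Isomorphic (B.directSum D) := by
  obtain ⟨f, hf, hb⟩ := isomorphic_iff.1 h
  obtain ⟨g, hg, hb'⟩ := isomorphic_iff.1 h'
  rw [mem_homSpace] at hf hg
  exact isomorphic_iff.2 ⟨fun x => (f x).prodMap (g x), mem_homSpace.2 fun a w =>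
    Prod.ext (hf a w.1) (hg a w.2), fun x => (hb x).prodMap (hb' x)⟩

theorem isomorphic_of_dim_eq_zero (hA : A.dim = 0) (hB : B.dim = 0) : A.Isomorphic B := by
  rw [dim_eq_zero_iff] at hA hB
  exact isomorphic_iff.2 ⟨0, zero_mem _, fun x =>
    ⟨fun w w' _ => by rw [hA x w, hA x w'], fun w => ⟨0, by rw [hB x w, map_zero]⟩⟩⟩

end Representation

open Biquiver.Representation

/-- A representation is zero, indecomposable, or a direct sum of two of smaller total dimension,
which by induction run through a finite list. -/
theorem RepresentationFinite.finite_totalDim_le [Fintype V] (h : G.RepresentationFinite) (n : ℕ) :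
    ∃ T : Set G.Representation, T.Finite ∧
      ∀ A : G.Representation, A.totalDim ≤ n → ∃ B ∈ T, A.Isomorphic B := by
  obtain ⟨S, hS, hS'⟩ := h
  obtain ⟨Z, hZ⟩ := exists_dim_eq G 0
  induction n with
  | zero =>
    refine ⟨{Z}, Set.finite_singleton Z, fun A hA => ⟨Z, rfl, isomorphic_of_dim_eq_zero ?_ hZ⟩⟩
    by_contra h0
    have := totalDim_pos h0
    omega
  | succ n ih =>
    obtain ⟨T, hT, hT'⟩ := ih
    refine ⟨{Z} ∪ S ∪ Set.image2 directSum T T,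
      ((Set.finite_singleton Z).union hS).union (hT.image2 _ hT), fun A hA => ?_⟩
    by_cases h0 : A.dim = 0
    · exact ⟨Z, Or.inl (Or.inl rfl), isomorphic_of_dim_eq_zero h0 hZ⟩
    by_cases hind : A.Indecomposable
    · obtain ⟨B, hB, hAB⟩ := hS' A hind
      exact ⟨B, Or.inl (Or.inr hB), hAB⟩
    · obtain ⟨B, C, hB, hC, hABC⟩ : ∃ B C : G.Representation, B.dim ≠ 0 ∧ C.dim ≠ 0 ∧
          A.Isomorphic (B.directSum C) := by
        by_contra hcon
        exact hind ⟨h0, hcon⟩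
      have h1 := hABC.totalDim_eq
      rw [totalDim_directSum] at h1
      have h2 := totalDim_pos hB
      have h3 := totalDim_pos hC
      obtain ⟨B', hB', hBB'⟩ := hT' B (by omega)
      obtain ⟨C', hC', hCC'⟩ := hT' C (by omega)
      exact ⟨_, Or.inr ⟨B', hB', C', hC', rfl⟩, hABC.trans (hBB'.directSum hCC')⟩

/-- The image of an affine hyperplane under a continuously differentiable mapping has smaller
dimension than the space. -/
theorem dimH_image_hyperplane_add_one_le {P M : Type*} [NormedAddCommGroup P] [NormedSpace ℝ P]
    [FiniteDimensional ℝ P] [NormedAddCommGroup M] [NormedSpace ℝ M] {f : P → M} {U : Set P}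
    (hf : ∀ p ∈ U, ContDiffAt ℝ 1 f p) (hP : 0 < Module.finrank ℝ P)
    (l : P →ₗ[ℝ] ℝ) : dimH (f '' (U ∩ {p | l p = 1})) + 1 ≤ Module.finrank ℝ P := by
  rcases Set.eq_empty_or_nonempty (U ∩ {p | l p = 1}) with h | ⟨p₀, -, hp₀⟩
  · rw [h, Set.image_empty, dimH_empty, zero_add]
    exact_mod_cast hP
  have hl : LinearMap.range l = ⊤ := by
    rw [LinearMap.range_eq_top]
    intro r
    exact ⟨r • p₀, by rw [map_smul, hp₀, smul_eq_mul, mul_one]⟩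
  have hrank : Module.finrank ℝ (LinearMap.ker l) + 1 = Module.finrank ℝ P := by
    have := LinearMap.finrank_range_add_finrank_ker l
    rw [hl, finrank_top, Module.finrank_self] at this
    omega
  -- The hyperplane is parametrized by the kernel of `l`, one dimension lower; locally Lipschitz
  -- mappings do not raise Hausdorff dimension.
  let s : LinearMap.ker l → P := fun k => p₀ + k
  have hs : ContDiff ℝ 1 s := contDiff_const.add (LinearMap.ker l).subtypeL.contDiff
  have himage : f '' (U ∩ {p | l p = 1}) ⊆ (f ∘ s) '' (s ⁻¹' U) := by
    rintro _ ⟨p, ⟨hp, hp1⟩, rfl⟩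
    have hk : p - p₀ ∈ LinearMap.ker l := by
      rw [LinearMap.mem_ker, map_sub, sub_eq_zero]; exact hp1.trans hp₀.symm
    have hsp : s ⟨p - p₀, hk⟩ = p := by simp [s]
    exact ⟨⟨p - p₀, hk⟩, by rw [Set.mem_preimage, hsp]; exact hp, by
      rw [Function.comp_apply, hsp]⟩
  have h1 : dimH ((f ∘ s) '' (s ⁻¹' U)) ≤ dimH (s ⁻¹' U) := by
    refine dimH_image_le_of_locally_lipschitzOn fun k hk => ?_
    obtain ⟨C, t, ht, hL⟩ :=
      ((hf _ hk).comp k hs.contDiffAt).exists_lipschitzOnWith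
    exact ⟨C, t, mem_nhdsWithin_of_mem_nhds ht, hL⟩
  calc dimH (f '' (U ∩ {p | l p = 1})) + 1
      ≤ dimH (Set.univ : Set (LinearMap.ker l)) + 1 :=
        add_le_add_left ((dimH_mono himage).trans (h1.trans (dimH_mono (Set.subset_univ _)))) 1
    _ = Module.finrank ℝ P := by
        rw [Real.dimH_univ_eq_finrank, ← hrank]; push_cast; rfl

section Coordinates

variable (z : V → ℕ)

/-- The coordinates of a family of linear endomorphisms of the coordinate spaces. -/
abbrev FamilyCoords := ∀ x, Fin (z x) → Fin (z x) → ℂ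

/-- The coordinates of a representation on the coordinate spaces. -/
abbrev MapCoords (G : Biquiver V E) (z : V → ℕ) :=
  ∀ a, Fin (z (G.src a)) → Fin (z (G.tgt a)) → ℂ

/-- The representation on the coordinate spaces with the given values on the standard bases. -/
noncomputable def ofCoords (m : MapCoords G z) : G.Representation where
  space x := Fin (z x) → ℂ
  map a := (semilinearEquiv (Pi.basisFun ℂ (Fin (z (G.src a)))) (G.twist a)).symm (m a)

variable {z}

theorem dim_ofCoords (m : MapCoords G z) : (ofCoords z m).dim = z := by
  funext x
  exact Module.finrank_fin_fun ℂ

/-- The change of bases in the spaces of a representation. -/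
noncomputable def changeBasis (m : MapCoords G z) (F : FamilyCoords z) : MapCoords G z :=
  fun a j i => ∑ k, F (G.tgt a) i k *
    ∑ l, G.twist a ((Matrix.of (F (G.src a)))⁻¹ l j) * m a l k

/-- The commutation relation, evaluated at the preimages under `f` of the standard basis vectors,
solves for `n`. -/
theorem changeBasis_eq {m n : MapCoords G z} {f : ∀ x, (Fin (z x) → ℂ) →ₗ[ℂ] (Fin (z x) → ℂ)}
    (hf : ∀ a w, ∑ i, G.twist a (f (G.src a) w i) • n a i =
      f (G.tgt a) (∑ i, G.twist a (w i) • m a i)) (hb : ∀ x, Function.Bijective (f x)) :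
    (∀ x, (LinearMap.toMatrix' (f x)).det ≠ 0) ∧
      changeBasis m (fun x => LinearMap.toMatrix' (f x)) = n := by
  let g := fun x => (LinearEquiv.ofBijective (f x) (hb x)).symm
  have hfg : ∀ x w, f x (g x w) = w := fun x w =>
    (LinearEquiv.ofBijective (f x) (hb x)).apply_symm_apply w
  have hmul : ∀ x, LinearMap.toMatrix' (f x) * LinearMap.toMatrix' (g x).toLinearMap = 1 := by
    intro x
    rw [← LinearMap.toMatrix'_comp, ← LinearMap.toMatrix'_id]
    exact congrArg _ (LinearMap.ext (hfg x))
  refine ⟨fun x h => ?_, ?_⟩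
  · have := congrArg Matrix.det (hmul x)
    rw [Matrix.det_mul, h, zero_mul, Matrix.det_one] at this
    exact zero_ne_one this
  · funext a j i
    have hinv : (Matrix.of (LinearMap.toMatrix' (f (G.src a))))⁻¹ =
        LinearMap.toMatrix' (g (G.src a)).toLinearMap := Matrix.inv_eq_right_inv (hmul _)
    have h1 := hf a (g (G.src a) (Pi.single j 1))
    rw [hfg] at h1
    have h2 : ∑ i, G.twist a ((Pi.single j 1 : Fin (z (G.src a)) → ℂ) i) • n a i = n a j := by
      rw [Finset.sum_eq_single j]
      · simp
      · intro i _ hij; simp [hij]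
      · simp
    rw [h2, ← LinearMap.toMatrix'_mulVec] at h1
    rw [h1]
    simp only [changeBasis, hinv, LinearMap.toMatrix'_apply, Matrix.mulVec, dotProduct,
      Finset.sum_apply, Pi.smul_apply, smul_eq_mul]
    rfl

/-- Cramer's rule expresses the inverse through determinants, and conjugation is real linear. -/
theorem contDiffAt_changeBasis [Fintype V] [Fintype E] (m : MapCoords G z)
    {F : FamilyCoords z} (hF : ∀ x, (Matrix.of (F x)).det ≠ 0) : ContDiffAt ℝ 1 (changeBasis m) F := by
  have hentry : ∀ x i j, ContDiff ℝ 1 fun F : FamilyCoords z => F x i j := by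
    exact fun x i j => contDiff_pi.1 (contDiff_pi.1 (contDiff_pi.1 contDiff_id x) i) j
  have hdet : ∀ x (M : FamilyCoords z → Matrix (Fin (z x)) (Fin (z x)) ℂ),
      (∀ i j, ContDiff ℝ 1 fun F => M F i j) → ContDiff ℝ 1 fun F => (M F).det := by
    intro x M hM
    simp only [Matrix.det_apply']
    exact ContDiff.sum fun σ _ => contDiff_const.mul (contDiff_prod fun i _ => hM _ _)
  have hinv : ∀ x i j, ContDiffAt ℝ 1 (fun F : FamilyCoords z => (Matrix.of (F x))⁻¹ i j) F := by
    intro x i j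
    simp only [Matrix.inv_def, Ring.inverse_eq_inv', Matrix.smul_apply, smul_eq_mul]
    refine ((hdet x _ (hentry x)).contDiffAt.inv (hF x)).mul (ContDiff.contDiffAt ?_)
    simp only [Matrix.adjugate_apply]
    refine hdet x _ fun k l => ?_
    simp only [Matrix.updateRow_apply]
    split_ifs
    · exact contDiff_const
    · exact hentry x k l
  have htwist : ∀ a, ContDiff ℝ 1 (G.twist a) := by
    intro a
    unfold twist
    split_ifs
    · exact Complex.conjCLE.contDiff
    · exact contDiff_id
  refine contDiffAt_pi.2 fun a => contDiffAt_pi.2 fun j => contDiffAt_pi.2 fun i => ?_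
  refine ContDiffAt.sum fun k _ => (hentry _ _ _).contDiffAt.mul
    (ContDiffAt.sum fun l _ => ContDiffAt.mul ?_ contDiffAt_const)
  exact (htwist a).contDiffAt.comp F (hinv _ _ _)

theorem finrank_familyCoords [Fintype V] (z : V → ℕ) :
    Module.finrank ℝ (FamilyCoords z) = 2 * ∑ x, z x * z x := by
  simp only [Module.finrank_pi_fintype, Complex.finrank_real_complex, Finset.sum_const,
    Finset.card_univ, Fintype.card_fin, smul_eq_mul, Finset.mul_sum]
  exact Finset.sum_congr rfl fun x _ => by ring

theorem finrank_mapCoords [Fintype E] (G : Biquiver V E) (z : V → ℕ) :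
    Module.finrank ℝ (MapCoords G z) = 2 * ∑ a, z (G.src a) * z (G.tgt a) := by
  simp only [Module.finrank_pi_fintype, Complex.finrank_real_complex, Finset.sum_const,
    Finset.card_univ, Fintype.card_fin, smul_eq_mul, Finset.mul_sum]
  exact Finset.sum_congr rfl fun x _ => by ring

variable [Fintype V] [Fintype E]

/-- The real coordinates in the space of families. -/
noncomputable def realCoord (i : (Σ x, Fin (z x) × Fin (z x)) × Bool) : FamilyCoords z →ₗ[ℝ] ℝ :=
  (if i.2 then Complex.reLm else Complex.imLm) ∘ₗ LinearMap.proj i.1.2.2 ∘ₗ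
    LinearMap.proj i.1.2.1 ∘ₗ LinearMap.proj i.1.1

/-- An isomorphism class has smaller dimension than the space of families. -/
theorem dimH_isomorphic_add_one_le (hz : z ≠ 0) (B : G.Representation) :
    dimH {n : MapCoords G z | (ofCoords z n).Isomorphic B} + 1 ≤
      Module.finrank ℝ (FamilyCoords z) := by
  obtain ⟨x₀, hx₀⟩ := Function.ne_iff.1 hz
  have hP : 0 < Module.finrank ℝ (FamilyCoords z) := by
    rw [finrank_familyCoords]
    have : 0 < ∑ x, z x * z x := Finset.sum_pos' (fun _ _ => Nat.zero_le _)
      ⟨x₀, Finset.mem_univ _, Nat.mul_pos (Nat.pos_of_ne_zero hx₀) (Nat.pos_of_ne_zero hx₀)⟩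
    omega
  rcases Set.eq_empty_or_nonempty {n : MapCoords G z | (ofCoords z n).Isomorphic B} with h | ⟨m, hm⟩
  · rw [h, dimH_empty, zero_add]
    exact_mod_cast hP
  let U : Set (FamilyCoords z) := {F | ∀ x, (Matrix.of (F x)).det ≠ 0}
  -- Real scalars commute with every arrow mapping, so an isomorphism can be rescaled until a
  -- nonzero real coordinate becomes 1. The class is thus covered by the images of finitely many
  -- hyperplanes, which saves one dimension.
  have hsub : {n : MapCoords G z | (ofCoords z n).Isomorphic B} ⊆
      ⋃ i, changeBasis m '' (U ∩ {F | realCoord i F = 1}) := by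
    intro n hn
    obtain ⟨f, hf, hfb⟩ := isomorphic_iff.1 (Isomorphic.trans hm (Isomorphic.symm hn))
    obtain ⟨i, hi⟩ : ∃ i, realCoord i
        (fun x => LinearMap.toMatrix' (f x : (Fin (z x) → ℂ) →ₗ[ℂ] (Fin (z x) → ℂ))) ≠ 0 := by
      by_contra! hcon
      let e : Fin (z x₀) → ℂ := Pi.single ⟨0, Nat.pos_of_ne_zero hx₀⟩ 1
      have he : f x₀ e = 0 := by
        funext j
        exact Complex.ext (hcon (⟨x₀, j, ⟨0, Nat.pos_of_ne_zero hx₀⟩⟩, true))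
          (hcon (⟨x₀, j, ⟨0, Nat.pos_of_ne_zero hx₀⟩⟩, false))
      have he0 : e = 0 := (hfb x₀).1 (he.trans (map_zero (f x₀)).symm)
      simpa [e] using congrFun he0 ⟨0, Nat.pos_of_ne_zero hx₀⟩
    set r := realCoord i
        (fun x => LinearMap.toMatrix' (f x : (Fin (z x) → ℂ) →ₗ[ℂ] (Fin (z x) → ℂ))) with hr
    let f' : ∀ x, (Fin (z x) → ℂ) →ₗ[ℂ] (Fin (z x) → ℂ) := fun x => r⁻¹ • f x
    have hf' : ∀ a w, ∑ i, G.twist a (f' (G.src a) w i) • n a i =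
        f' (G.tgt a) (∑ i, G.twist a (w i) • m a i) :=
      mem_homSpace.1 (Submodule.smul_mem _ r⁻¹ hf)
    have hb' : ∀ x, Function.Bijective (f' x) := fun x =>
      (MulAction.bijective₀ (inv_ne_zero hi)).comp (hfb x)
    obtain ⟨h1, h2⟩ := changeBasis_eq hf' hb'
    refine Set.mem_iUnion.2 ⟨i, _, ⟨h1, ?_⟩, h2⟩
    have h3 : (fun x => LinearMap.toMatrix' (f' x) : FamilyCoords z) = r⁻¹ •
        (fun x => LinearMap.toMatrix' (f x : (Fin (z x) → ℂ) →ₗ[ℂ] (Fin (z x) → ℂ)) :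
          FamilyCoords z) := rfl
    exact (congrArg (realCoord i) h3).trans (((realCoord i).map_smul _ _).trans
      (inv_mul_cancel₀ hi))
  have hle : ∀ i, dimH (changeBasis m '' (U ∩ {F | realCoord i F = 1})) + 1 ≤
      Module.finrank ℝ (FamilyCoords z) := fun i =>
    dimH_image_hyperplane_add_one_le (fun F hF => contDiffAt_changeBasis m hF) hP _
  obtain ⟨d, hd⟩ := Nat.exists_eq_succ_of_ne_zero hP.ne'
  rw [hd] at hle ⊢
  push_cast at hle ⊢
  refine add_le_add_left ((dimH_mono hsub).trans ?_) 1
  rw [dimH_iUnion]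
  exact iSup_le fun i => (ENNReal.add_le_add_iff_right ENNReal.one_ne_top).1 (hle i)

/-- Finitely many isomorphism classes cover the space of coordinates, so its dimension is at most
that of the space of families minus 1; the difference of these dimensions is twice the Euler form.
-/
theorem RepresentationFinite.eulerForm_pos (h : G.RepresentationFinite) (hz : z ≠ 0) :
    0 < eulerForm G z z := by
  obtain ⟨T, hT, hcover⟩ := h.finite_totalDim_le (∑ x, z x)
  have huniv : (Set.univ : Set (MapCoords G z)) =
      ⋃ B ∈ T, {n : MapCoords G z | (ofCoords z n).Isomorphic B} := by
    refine (Set.eq_univ_of_forall fun n => ?_).symm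
    obtain ⟨B, hB, hn⟩ := hcover (ofCoords z n) (by rw [totalDim, dim_ofCoords])
    exact Set.mem_biUnion hB hn
  by_contra! hneg
  have hrank : Module.finrank ℝ (FamilyCoords z) ≤ Module.finrank ℝ (MapCoords G z) := by
    rw [finrank_familyCoords, finrank_mapCoords]
    unfold eulerForm at hneg
    zify
    linarith
  have h1 : dimH (Set.univ : Set (MapCoords G z)) + 1 ≤ Module.finrank ℝ (FamilyCoords z) := by
    have hne : Module.finrank ℝ (FamilyCoords z) ≠ 0 := by
      intro h0
      have := dimH_isomorphic_add_one_le hz (ofCoords z (0 : MapCoords G z))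
      rw [h0] at this
      simp at this
    obtain ⟨d, hd⟩ := Nat.exists_eq_succ_of_ne_zero hne
    rw [hd]
    push_cast
    refine add_le_add_left ?_ 1
    rw [huniv, dimH_bUnion hT.countable]
    refine iSup₂_le fun B _ => ?_
    have := dimH_isomorphic_add_one_le hz B
    rw [hd] at this
    push_cast at this
    exact (ENNReal.add_le_add_iff_right ENNReal.one_ne_top).1 this
  rw [Real.dimH_univ_eq_finrank] at h1
  have h2 : Module.finrank ℝ (MapCoords G z) + 1 ≤ Module.finrank ℝ (FamilyCoords z) := by
    exact_mod_cast h1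
  omega

/-- Passing to absolute values keeps the squares and can only enlarge the subtracted products, so
nonnegative vectors suffice. -/
theorem RepresentationFinite.posDef (h : G.RepresentationFinite) : G.titsForm.PosDef := by
  intro z hz
  have hz' : (fun x => (z x).natAbs) ≠ 0 := by
    intro h0
    exact hz (funext fun x => Int.natAbs_eq_zero.1 (congrFun h0 x))
  have h1 := h.eulerForm_pos hz'
  rw [← titsForm_eq_eulerForm, titsForm_apply] at h1
  rw [titsForm_apply]
  have h2 : ∑ a, z (G.src a) * z (G.tgt a) ≤
      ∑ a, ((z (G.src a)).natAbs : ℤ) * ((z (G.tgt a)).natAbs : ℤ) := by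
    refine Finset.sum_le_sum fun a _ => ?_
    rw [← Nat.cast_mul, ← Int.natAbs_mul]
    exact Int.le_natAbs
  simp only [Int.natCast_natAbs, sq_abs] at h1 h2
  linarith

end Coordinates

end Biquiver

/-! ### Dynkin diagrams have positive definite Tits forms -/

namespace Biquiver

universe u v

variable {V : Type u} {E : Type v} {G : Biquiver V E}

theorem adj_of_edgeEquiv {W : Type*} {D : SimpleGraph W} {f : V ≃ W} {g : E ≃ D.edgeSet}
    (hg : ∀ a, (g a : Sym2 W) = s(f (G.src a), f (G.tgt a))) (a : E) :
    D.Adj (f (G.src a)) (f (G.tgt a)) := by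
  rw [← SimpleGraph.mem_edgeSet, ← hg]
  exact (g a).2

/-- A sum over the arrows as a sum over the ordered pairs of adjacent vertices. -/
theorem two_mul_sum_arrows [Fintype E] {W : Type*} [Fintype W] {D : SimpleGraph W}
    [DecidableRel D.Adj] {f : V ≃ W} {g : E ≃ D.edgeSet}
    (hg : ∀ a, (g a : Sym2 W) = s(f (G.src a), f (G.tgt a))) (z : W → ℤ) :
    2 * ∑ a, z (f (G.src a)) * z (f (G.tgt a)) =
      ∑ x, ∑ y, if D.Adj x y then z x * z y else 0 := by
  have hadj := adj_of_edgeEquiv hg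
  rw [← Finset.sum_product', Finset.univ_product_univ, ← Finset.sum_filter]
  have : 2 * ∑ a, z (f (G.src a)) * z (f (G.tgt a)) =
      ∑ p : E × Bool, z (f (G.src p.1)) * z (f (G.tgt p.1)) := by
    rw [Fintype.sum_prod_type]
    simp [Finset.mul_sum, two_mul]
  rw [this]
  -- The Boolean records in which of its two directions an edge is read.
  refine Finset.sum_nbij (fun p => if p.2 then (f (G.src p.1), f (G.tgt p.1))
    else (f (G.tgt p.1), f (G.src p.1))) ?_ ?_ ?_ ?_
  · rintro ⟨a, b⟩ -
    cases b
    · simpa using (hadj a).symm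
    · simpa using hadj a
  · rintro ⟨a, b⟩ - ⟨a', b'⟩ - h
    have hs : s(f (G.src a), f (G.tgt a)) = s(f (G.src a'), f (G.tgt a')) := by
      cases b <;> cases b' <;> simp only [Bool.false_eq_true, if_true, if_false, Prod.mk.injEq] at h
      · rw [h.1, h.2]
      · rw [h.1, h.2]; exact Sym2.eq_swap
      · rw [h.1, h.2]; exact Sym2.eq_swap
      · rw [h.1, h.2]
    rw [← hg, ← hg] at hs
    obtain rfl := g.injective (Subtype.ext hs)
    have hne := (hadj a).ne
    cases b <;> cases b' <;> simp only [Bool.false_eq_true, if_true, if_false, Prod.mk.injEq] at h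
    · rfl
    · exact (hne h.2).elim
    · exact (hne h.1).elim
    · rfl
  · rintro ⟨x, y⟩ h
    replace h : D.Adj x y := by simpa using h
    obtain ⟨a, ha⟩ := g.surjective ⟨s(x, y), h⟩
    have h1 := hg a
    rw [ha] at h1
    rcases Sym2.eq_iff.1 h1 with ⟨h2, h3⟩ | ⟨h2, h3⟩
    · exact ⟨(a, true), by simp, by simp [h2, h3]⟩
    · exact ⟨(a, false), by simp, by simp [h2, h3]⟩
  · rintro ⟨a, b⟩ -
    cases b <;> simp [mul_comm]

/-- A completion of squares for the quadratic form of a graph. -/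
theorem sum_sq_sub_eq {W : Type*} [Fintype W] (c : W → W → ℝ) (hc : ∀ x y, c x y = c y x)
    (d y : W → ℝ) :
    4 * ∑ v, (d v * y v) ^ 2 - 2 * ∑ v, ∑ w, c v w * ((d v * y v) * (d w * y w)) =
      2 * ∑ v, d v * y v ^ 2 * (2 * d v - ∑ w, c v w * d w) +
        ∑ v, ∑ w, c v w * (d v * d w) * (y v - y w) ^ 2 := by
  have h1 : ∑ v, ∑ w, c v w * (d v * d w) * y w ^ 2 = ∑ v, ∑ w, c v w * (d v * d w) * y v ^ 2 := by
    rw [Finset.sum_comm]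
    exact Finset.sum_congr rfl fun v _ => Finset.sum_congr rfl fun w _ => by rw [hc]; ring
  have h2 : ∑ v, ∑ w, c v w * (d v * d w) * (y v - y w) ^ 2 =
      ∑ v, ∑ w, c v w * (d v * d w) * y v ^ 2 + ∑ v, ∑ w, c v w * (d v * d w) * y w ^ 2 -
        2 * ∑ v, ∑ w, c v w * ((d v * y v) * (d w * y w)) := by
    simp only [Finset.mul_sum, ← Finset.sum_add_distrib, ← Finset.sum_sub_distrib]
    exact Finset.sum_congr rfl fun v _ => Finset.sum_congr rfl fun w _ => by ring
  have h3 : ∑ v, d v * y v ^ 2 * (2 * d v - ∑ w, c v w * d w) =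
      2 * ∑ v, (d v * y v) ^ 2 - ∑ v, ∑ w, c v w * (d v * d w) * y v ^ 2 := by
    simp only [Finset.mul_sum, ← Finset.sum_sub_distrib, mul_sub]
    refine Finset.sum_congr rfl fun v _ => ?_
    congr 1
    · ring
    · exact Finset.sum_congr rfl fun w _ => by ring
  rw [h2, h3, h1]
  ring

/-- The Tits form is positive definite if there is a positive subadditive function on the
vertices that is not additive. -/
theorem posDef_of_subadditive [Fintype V] [Fintype E] (hG : G.Connected) {W : Type*} [Fintype W]
    {D : SimpleGraph W} [DecidableRel D.Adj] (hD : G.IsObtainedFrom D) {d : W → ℤ}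
    (hd : ∀ v, 0 < d v) (hsub : ∀ v, (∑ w, if D.Adj v w then d w else 0) ≤ 2 * d v) {v₀ : W}
    (hv₀ : (∑ w, if D.Adj v₀ w then d w else 0) < 2 * d v₀) : G.titsForm.PosDef := by
  classical
  obtain ⟨f, g, hg⟩ := hD
  intro z hz
  by_contra! hneg
  have hsum := two_mul_sum_arrows hg (z ∘ f.symm)
  simp only [Function.comp_apply, Equiv.symm_apply_apply] at hsum
  have hsq : ∑ x, z x ^ 2 = ∑ v, z (f.symm v) ^ 2 :=
    (Equiv.sum_comp f.symm fun x => z x ^ 2).symm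
  rw [titsForm_apply] at hneg
  let c : W → W → ℝ := fun v w => if D.Adj v w then 1 else 0
  have hc0 : ∀ v w, 0 ≤ c v w := fun v w => by simp only [c]; split_ifs <;> simp
  have hd' : ∀ v, (0 : ℝ) < d v := fun v => Int.cast_pos.2 (hd v)
  -- With z = d · y, `sum_sq_sub_eq` writes four times the form as a sum of terms that subadditivity
  -- makes nonnegative.
  let y : W → ℝ := fun v => z (f.symm v) / d v
  have hy : ∀ v, (d v : ℝ) * y v = z (f.symm v) := fun v => mul_div_cancel₀ _ (hd' v).ne'
  have hS : ∀ v, ∑ w, c v w * d w = ((∑ w, if D.Adj v w then d w else 0 : ℤ) : ℝ) := by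
    intro v
    push_cast
    exact Finset.sum_congr rfl fun w _ => by simp [c]
  have hid := sum_sq_sub_eq c (fun v w => by simp only [c, D.adj_comm]) (fun v => (d v : ℝ)) y
  simp only [hy, hS] at hid
  have hle : 4 * ∑ v, (z (f.symm v) : ℝ) ^ 2 -
      2 * ∑ v, ∑ w, c v w * ((z (f.symm v) : ℝ) * z (f.symm w)) ≤ 0 := by
    have : ∑ v, ∑ w, c v w * ((z (f.symm v) : ℝ) * z (f.symm w)) =
        ((∑ v, ∑ w, if D.Adj v w then z (f.symm v) * z (f.symm w) else 0 : ℤ) : ℝ) := by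
      push_cast
      exact Finset.sum_congr rfl fun v _ => Finset.sum_congr rfl fun w _ => by simp [c]
    rw [this, ← hsum]
    have h1 : 4 * ∑ v, z (f.symm v) ^ 2 - 2 * (2 * ∑ a, z (G.src a) * z (G.tgt a)) ≤ 0 := by
      rw [← hsq]; linarith
    exact_mod_cast h1
  have hT1 : ∀ v, 0 ≤ (d v : ℝ) * y v ^ 2 *
      (2 * d v - ((∑ w, if D.Adj v w then d w else 0 : ℤ) : ℝ)) := by
    intro v
    refine mul_nonneg (mul_nonneg (hd' v).le (sq_nonneg _)) (sub_nonneg.2 ?_)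
    exact_mod_cast hsub v
  have hT2 : ∀ v w, 0 ≤ c v w * ((d v : ℝ) * d w) * (y v - y w) ^ 2 := fun v w =>
    mul_nonneg (mul_nonneg (hc0 v w) (mul_nonneg (hd' v).le (hd' w).le)) (sq_nonneg _)
  have hs1 := Finset.sum_nonneg fun v (_ : v ∈ Finset.univ) => hT1 v
  have hs2 := Finset.sum_nonneg fun v (_ : v ∈ Finset.univ) =>
    Finset.sum_nonneg fun w (_ : w ∈ Finset.univ) => hT2 v w
  -- A nonpositive value makes every term vanish: `y` is zero at `v₀`, where the inequality is
  -- strict, and constant along edges, so connectedness gives z = 0.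
  have hz1 := (Finset.sum_eq_zero_iff_of_nonneg fun v _ => hT1 v).1
    (by linarith) v₀ (Finset.mem_univ _)
  have hz2 : ∀ v w, c v w * ((d v : ℝ) * d w) * (y v - y w) ^ 2 = 0 := by
    intro v w
    refine (Finset.sum_eq_zero_iff_of_nonneg fun w _ => hT2 v w).1 ?_ w (Finset.mem_univ _)
    exact (Finset.sum_eq_zero_iff_of_nonneg fun v _ => Finset.sum_nonneg fun w _ => hT2 v w).1
      (by linarith) v (Finset.mem_univ _)
  have hy0 : ∀ v, y v = 0 → z (f.symm v) = 0 := fun v h => by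
    have := hy v
    rw [h, mul_zero] at this
    exact_mod_cast this.symm
  have hv0 : z (f.symm v₀) = 0 := by
    refine hy0 _ ?_
    have hpos : (0 : ℝ) < 2 * d v₀ - ((∑ w, if D.Adj v₀ w then d w else 0 : ℤ) : ℝ) :=
      sub_pos.2 (by exact_mod_cast hv₀)
    have h0 := (mul_eq_zero.1 hz1).resolve_right hpos.ne'
    exact pow_eq_zero_iff two_ne_zero |>.1 ((mul_eq_zero.1 h0).resolve_left (hd' v₀).ne')
  obtain ⟨x, hx⟩ := Function.ne_iff.1 hz
  obtain ⟨x, x', h1, h2, h3⟩ := hG.exists_adj (S := {x | z x = 0}) ⟨f.symm v₀, by simpa using hv0⟩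
    (y := x) (by simpa using hx)
  rw [Finset.mem_filter_univ] at h1 h2
  have hadj : D.Adj (f x) (f x') := by
    obtain ⟨-, a, ⟨rfl, rfl⟩ | ⟨rfl, rfl⟩⟩ := adj_iff.1 h3
    · exact adj_of_edgeEquiv hg a
    · exact (adj_of_edgeEquiv hg a).symm
  have h4 := hz2 (f x) (f x')
  have h5 : y (f x) = 0 := by simp [y, h1]
  rw [h5] at h4
  have h6 : y (f x') = 0 := by
    simpa [c, hadj, (hd' (f x)).ne', (hd' (f x')).ne'] using h4
  exact h2 (by simpa using hy0 _ h6)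

theorem sum_fin_ite_le (n c : ℕ) (p : Prop) [Decidable p] {K : ℤ} (hK : 0 ≤ K) :
    (∑ w : Fin n, if p ∧ w.val = c then K else 0) ≤ if p then K else 0 := by
  by_cases hp : p
  · simp only [hp, true_and, if_true]
    by_cases hc : c < n
    · rw [Finset.sum_eq_single ⟨c, hc⟩]
      · simp
      · intro w _ hw
        rw [if_neg fun h => hw (Fin.ext h)]
      · simp
    · rw [Finset.sum_eq_zero fun w _ => if_neg fun h : w.val = c => hc (h ▸ w.2)]
      exact hK
  · simp [hp]

theorem branchGraph_adj {n k : ℕ} {i j : Fin n} : (branchGraph n k).Adj i j ↔ i ≠ j ∧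
    (((i.val + 1 = j.val ∧ j.val + 1 < n) ∨ (i.val = k ∧ j.val + 1 = n)) ∨
      ((j.val + 1 = i.val ∧ i.val + 1 < n) ∨ (j.val = k ∧ i.val + 1 = n))) := by
  rw [branchGraph, SimpleGraph.fromRel_adj]

/-- The summands account for the possible neighbours: the next path vertex, the pendant vertex seen
from `k`, the previous path vertex, and `k` seen from the pendant vertex. An upper bound is enough
for subadditivity. -/
theorem sum_branchGraph_le (n k : ℕ) [DecidableRel (branchGraph n k).Adj] {d : ℕ → ℤ}
    (hd : ∀ i, 0 ≤ d i) (v : Fin n) :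
    (∑ w, if (branchGraph n k).Adj v w then d w.val else 0) ≤
      (if v.val + 2 < n then d (v.val + 1) else 0) + (if v.val = k then d (n - 1) else 0) +
      (if 1 ≤ v.val ∧ v.val + 1 < n then d (v.val - 1) else 0) +
      (if v.val + 1 = n then d k else 0) := by
  refine le_trans ?_ (add_le_add (add_le_add (add_le_add
    (sum_fin_ite_le n (v.val + 1) (v.val + 2 < n) (hd (v.val + 1)))
    (sum_fin_ite_le n (n - 1) (v.val = k) (hd (n - 1))))
    (sum_fin_ite_le n (v.val - 1) (1 ≤ v.val ∧ v.val + 1 < n) (hd (v.val - 1))))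
    (sum_fin_ite_le n k (v.val + 1 = n) (hd k)))
  rw [← Finset.sum_add_distrib, ← Finset.sum_add_distrib, ← Finset.sum_add_distrib]
  refine Finset.sum_le_sum fun w _ => ?_
  have hnn : ∀ (p : Prop) [Decidable p] (i : ℕ), 0 ≤ if p then d i else 0 := fun p _ i => by
    split_ifs
    · exact hd i
    · exact le_rfl
  have h1 := hnn (v.val + 2 < n ∧ w.val = v.val + 1) (v.val + 1)
  have h2 := hnn (v.val = k ∧ w.val = n - 1) (n - 1)
  have h3 := hnn ((1 ≤ v.val ∧ v.val + 1 < n) ∧ w.val = v.val - 1) (v.val - 1)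
  have h4 := hnn (v.val + 1 = n ∧ w.val = k) k
  by_cases hadj : (branchGraph n k).Adj v w
  · rw [if_pos hadj]
    rcases (branchGraph_adj.1 hadj).2 with (h | h) | (h | h)
    · rw [if_pos (c := v.val + 2 < n ∧ w.val = v.val + 1) (by omega)] at h1 ⊢
      have := congrArg d h.1
      linarith
    · have hw : w.val = n - 1 := by omega
      rw [if_pos (c := v.val = k ∧ w.val = n - 1) ⟨h.1, hw⟩] at h2 ⊢
      have := congrArg d hw
      linarith
    · have hw : w.val = v.val - 1 := by omega
      rw [if_pos (c := (1 ≤ v.val ∧ v.val + 1 < n) ∧ w.val = v.val - 1) (by omega)] at h3 ⊢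
      have := congrArg d hw
      linarith
    · rw [if_pos (c := v.val + 1 = n ∧ w.val = k) ⟨h.2, h.1⟩] at h4 ⊢
      have := congrArg d h.1
      linarith
  · rw [if_neg hadj]
    linarith

theorem sum_pathGraph_le (n : ℕ) [DecidableRel (SimpleGraph.pathGraph n).Adj] (v : Fin n) :
    (∑ w, if (SimpleGraph.pathGraph n).Adj v w then (1 : ℤ) else 0) ≤
      1 + if 1 ≤ v.val then 1 else 0 := by
  have h0 := sum_fin_ite_le n (v.val + 1) True (zero_le_one (α := ℤ))
  rw [if_pos trivial] at h0
  refine le_trans ?_ (add_le_add h0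
    (sum_fin_ite_le n (v.val - 1) (1 ≤ v.val) (zero_le_one (α := ℤ))))
  rw [← Finset.sum_add_distrib]
  refine Finset.sum_le_sum fun w _ => ?_
  by_cases hadj : (SimpleGraph.pathGraph n).Adj v w
  · rw [if_pos hadj]
    rw [SimpleGraph.pathGraph_adj] at hadj
    simp only [true_and]
    split_ifs <;> omega
  · rw [if_neg hadj]
    split_ifs <;> omega

variable [Fintype V] [Fintype E]

theorem posDef_of_dynkinA (hG : G.Connected) {n : ℕ} (hn : 1 ≤ n)
    (h : G.IsObtainedFrom (dynkinA n)) : G.titsForm.PosDef := by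
  classical
  refine posDef_of_subadditive hG h (d := fun _ => 1) (v₀ := ⟨0, hn⟩) (fun _ => one_pos)
    (fun v => (sum_pathGraph_le n v).trans ?_) ((sum_pathGraph_le n ⟨0, hn⟩).trans_lt ?_)
  · split_ifs <;> simp
  · simp

theorem posDef_of_dynkinD (hG : G.Connected) {n : ℕ} (hn : 4 ≤ n)
    (h : G.IsObtainedFrom (dynkinD n)) : G.titsForm.PosDef := by
  classical
  -- Weight 1 at the two short arms `n - 2` and `n - 1`, weight 2 elsewhere; strict at the far end
  -- 0.
  let d : ℕ → ℤ := fun i => if i + 2 < n then 2 else 1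
  have hd : ∀ i, 0 < d i := fun i => by simp only [d]; split_ifs <;> simp
  refine posDef_of_subadditive hG h (d := fun v => d v.val) (v₀ := ⟨0, by omega⟩) (fun v => hd _)
    (fun v => (sum_branchGraph_le n (n - 3) (fun i => (hd i).le) v).trans ?_)
    ((sum_branchGraph_le n (n - 3) (fun i => (hd i).le) _).trans_lt ?_)
  · have := v.2
    simp only [d]
    split_ifs <;> omega
  · simp only [d]
    split_ifs <;> omega

/-- A subadditive function on the Dynkin diagram `E_n`. -/
def weightE (n i : ℕ) : ℤ := if i + 1 = n then 3 else if i < 2 then 2 * (i + 1) else 8 - min i 7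

/-- `weightE` is the null vector 2, 4, 6, 5, 4, 3, 2, 1 with 3 on the short arm of extended E₈, with
its long arm cut off; the missing neighbour makes the inequality strict at `n - 2`. -/
theorem posDef_of_dynkinE (hG : G.Connected) {n : ℕ} (hn : 6 ≤ n) (hn' : n ≤ 8)
    (h : G.IsObtainedFrom (dynkinE n)) : G.titsForm.PosDef := by
  classical
  have hd : ∀ i, 0 < weightE n i := fun i => by unfold weightE; split_ifs <;> omega
  refine posDef_of_subadditive hG h (d := fun v => weightE n v.val) (v₀ := ⟨n - 2, by omega⟩)
    (fun v => hd _) (fun v => (sum_branchGraph_le n 2 (fun i => (hd i).le) v).trans ?_)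
    ((sum_branchGraph_le n 2 (fun i => (hd i).le) _).trans_lt ?_)
  · clear h hd
    revert v
    interval_cases n <;> decide
  · clear h hd
    interval_cases n <;> norm_num [weightE]

theorem IsDynkin.posDef (hG : G.Connected) (h : G.IsDynkin) : G.titsForm.PosDef := by
  rcases h with ⟨n, hn, h⟩ | ⟨n, hn, h⟩ | h | h | h
  · exact posDef_of_dynkinA hG hn h
  · exact posDef_of_dynkinD hG hn h
  · exact posDef_of_dynkinE hG (by norm_num) (by norm_num) h
  · exact posDef_of_dynkinE hG (by norm_num) (by norm_num) h
  · exact posDef_of_dynkinE hG (by norm_num) (by norm_num) h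

end Biquiver

/-! ### Positive definite Tits form implies Dynkin: longest paths and excluded subgraphs -/

namespace Biquiver

universe u v

variable {V : Type u} {E : Type v} {G : Biquiver V E}

/-- The vertices `x 0, …, x (m - 1)` are distinct and consecutive ones are adjacent. -/
def IsPathMap (G : Biquiver V E) (m : ℕ) (x : ℕ → V) : Prop :=
  (∀ i < m, ∀ j < m, x i = x j → i = j) ∧ ∀ i, i + 1 < m → G.toSimpleGraph.Adj (x i) (x (i + 1))

theorem IsPathMap.reverse {m : ℕ} {x : ℕ → V} (h : G.IsPathMap m x) :
    G.IsPathMap m fun i => x (m - 1 - i) := by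
  refine ⟨fun i hi j hj hij => ?_, fun i hi => ?_⟩
  · have := h.1 _ (by omega) _ (by omega) hij
    omega
  · have := h.2 (m - 1 - (i + 1)) (by omega)
    rw [show m - 1 - (i + 1) + 1 = m - 1 - i by omega] at this
    exact this.symm

theorem IsPathMap.tail {m : ℕ} {x : ℕ → V} (h : G.IsPathMap (m + 1) x) :
    G.IsPathMap m fun i => x (i + 1) := by
  refine ⟨fun i hi j hj hij => ?_, fun i hi => h.2 (i + 1) (by omega)⟩
  have := h.1 _ (by omega) _ (by omega) hij
  omega

theorem IsPathMap.cons {m : ℕ} {x : ℕ → V} (h : G.IsPathMap m x) {w : V}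
    (hw : ∀ i < m, x i ≠ w) (hadj : G.toSimpleGraph.Adj w (x 0)) :
    G.IsPathMap (m + 1) fun i => if i = 0 then w else x (i - 1) := by
  refine ⟨fun i hi j hj hij => ?_, fun i hi => ?_⟩
  · dsimp only at hij
    split_ifs at hij with h1 h2 h2
    · omega
    · exact (hw _ (by omega) hij.symm).elim
    · exact (hw _ (by omega) hij).elim
    · have := h.1 _ (by omega) _ (by omega) hij
      omega
  · dsimp only
    rcases i with - | i
    · simpa using hadj
    · simpa using h.2 i (by omega)

theorem IsPathMap.le_card [Fintype V] {m : ℕ} {x : ℕ → V} (h : G.IsPathMap m x) :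
    m ≤ Fintype.card V := by
  have := Fintype.card_le_of_injective (fun i : Fin m => x i) fun i j hij =>
    Fin.ext (h.1 _ i.2 _ j.2 hij)
  simpa using this

theorem injective_of_isPathMap {m : ℕ} {x : ℕ → V} (h : G.IsPathMap m x) {v : V}
    (hv : ∀ i < m, x i ≠ v) :
    Function.Injective fun i : Fin (m + 1) => if i.val < m then x i else v := by
  intro i j hij
  have hi := i.2
  have hj := j.2
  dsimp only at hij
  refine Fin.ext ?_
  split_ifs at hij with h1 h2 h3
  · exact h.1 _ h1 _ h2 hij
  · exact (hv _ h1 hij).elim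
  · exact (hv _ h3 hij.symm).elim
  · omega

theorem IsPathMap.sub {m : ℕ} {x : ℕ → V} (h : G.IsPathMap m x) {r s : ℕ} (hrs : s + r ≤ m) :
    G.IsPathMap r fun i => x (s + i) := by
  refine ⟨fun i hi j hj hij => ?_, fun i hi => h.2 (s + i) (by omega)⟩
  have := h.1 _ (by omega) _ (by omega) hij
  omega

/-- The set of the vertices `x i` for `j ≤ i ≤ l`. -/
def segment [DecidableEq V] (x : ℕ → V) (j l : ℕ) : Finset V := (Finset.Icc j l).image x

theorem mem_segment [DecidableEq V] {x : ℕ → V} {j l : ℕ} {y : V} :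
    y ∈ segment x j l ↔ ∃ i, (j ≤ i ∧ i ≤ l) ∧ x i = y := by
  simp [segment]

theorem IsPathMap.notMem_segment [DecidableEq V] {m : ℕ} {x : ℕ → V} (h : G.IsPathMap m x)
    {j l i : ℕ} (hl : l < m) (hi : i < m) (hij : i < j ∨ l < i) : x i ∉ segment x j l := by
  intro hmem
  obtain ⟨i', hi', heq⟩ := mem_segment.1 hmem
  have := h.1 _ (by omega) _ hi heq
  omega

variable [Fintype V] [Fintype E]

section Segments

variable [DecidableEq V]

theorem eq_of_adj (hq : G.titsForm.PosDef) {S : Finset V} (hS : G.titsForm (indicator S) ≤ 1)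
    {y : V} (hy : y ∉ S) {s t : V} (hs : s ∈ S) (ht : t ∈ S) (h : G.toSimpleGraph.Adj s y)
    (h' : G.toSimpleGraph.Adj t y) : s = t := by
  obtain ⟨-, a, ha⟩ := adj_iff.1 h
  obtain ⟨-, b, hb⟩ := adj_iff.1 h'
  have hne : s ≠ y := fun h => hy (h ▸ hs)
  have hne' : t ≠ y := fun h => hy (h ▸ ht)
  have hab : a = b := by
    refine eq_of_joins hq hS hy (a := a) (b := b) ?_ ?_
    · rcases ha with ⟨h1, h2⟩ | ⟨h1, h2⟩
      · exact Or.inl ⟨h1 ▸ hs, h2⟩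
      · exact Or.inr ⟨h1, h2 ▸ hs⟩
    · rcases hb with ⟨h1, h2⟩ | ⟨h1, h2⟩
      · exact Or.inl ⟨h1 ▸ ht, h2⟩
      · exact Or.inr ⟨h1, h2 ▸ ht⟩
  subst hab
  rcases ha with ⟨h1, h2⟩ | ⟨h1, h2⟩ <;> rcases hb with ⟨h3, h4⟩ | ⟨h3, h4⟩
  · exact h1.symm.trans h3
  · exact (hne' (h4.symm.trans h2)).elim
  · exact (hne' (h3.symm.trans h1)).elim
  · exact h2.symm.trans h4

theorem IsPathMap.titsForm_segment_le {m : ℕ} {x : ℕ → V} (h : G.IsPathMap m x) {j l : ℕ}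
    (hjl : j ≤ l) (hl : l < m) : G.titsForm (indicator (segment x j l)) ≤ 1 := by
  induction l, hjl using Nat.le_induction with
  | base =>
    rw [segment, Finset.Icc_self, Finset.image_singleton, indicator_singleton]
    exact titsForm_single_le G _
  | succ l hjl ih =>
    have h1 : segment x j (l + 1) = insert (x (l + 1)) (segment x j l) := by
      rw [segment, segment, ← Finset.image_insert]
      congr 1
      ext i
      simp only [Finset.mem_insert, Finset.mem_Icc]
      omega
    rw [h1]
    obtain ⟨a, ha⟩ := exists_joins_of_adj (S := segment x j l) (h.2 l hl)
      (mem_segment.2 ⟨l, ⟨hjl, le_rfl⟩, rfl⟩)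
    exact titsForm_insert_le_one (ih (by omega))
      (h.notMem_segment (by omega) hl (Or.inr (by omega))) ha

/-- A chord would join a vertex by two arrows to the segment before it, closing a cycle; so paths
are induced. -/
theorem IsPathMap.adj_iff (hq : G.titsForm.PosDef) {m : ℕ} {x : ℕ → V} (h : G.IsPathMap m x)
    {i j : ℕ} (hi : i < m) (hj : j < m) :
    G.toSimpleGraph.Adj (x i) (x j) ↔ i + 1 = j ∨ j + 1 = i := by
  have key : ∀ i j, j < m → i < j → G.toSimpleGraph.Adj (x i) (x j) → i + 1 = j := by
    intro i j hj hij hadj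
    obtain ⟨l, rfl⟩ : ∃ l, j = l + 1 := ⟨j - 1, by omega⟩
    have := eq_of_adj hq (h.titsForm_segment_le (j := i) (l := l) (by omega) (by omega))
      (h.notMem_segment (by omega) hj (Or.inr (by omega)))
      (mem_segment.2 ⟨i, ⟨le_rfl, by omega⟩, rfl⟩) (mem_segment.2 ⟨l, ⟨by omega, le_rfl⟩, rfl⟩)
      hadj (h.2 l hj)
    rw [h.1 _ (by omega) _ (by omega) this]
  constructor
  · intro hadj
    rcases lt_trichotomy i j with hlt | rfl | hlt
    · exact Or.inl (key i j hj hlt hadj)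
    · exact (hadj.ne rfl).elim
    · exact Or.inr (key j i hi hlt hadj.symm)
  · rintro (rfl | rfl)
    · exact h.2 i hj
    · exact (h.2 j hi).symm

/-- If the Tits form is positive definite then a connected set has at most three neighbours. -/
theorem card_neighbors_le_three (hq : G.titsForm.PosDef) {T : Finset V}
    (hT : G.titsForm (indicator T) ≤ 1) {N : Finset V}
    (hN : ∀ n ∈ N, n ∉ T ∧ ∃ s ∈ T, G.toSimpleGraph.Adj s n) : N.card ≤ 3 := by
  -- Each neighbour adds at most 1 for its square and at most −2 for its arrow to the doubled set,
  -- so four of them bring the value from 4 to 0, as in extended D.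
  have key : ∀ N : Finset V, (∀ n ∈ N, n ∉ T ∧ ∃ s ∈ T, G.toSimpleGraph.Adj s n) →
      G.titsForm ((2 : ℤ) • indicator T + indicator N) ≤ 4 - N.card := by
    intro N
    induction N using Finset.induction_on with
    | empty =>
      intro _
      have h0 : indicator (∅ : Finset V) = 0 := by funext y; simp [indicator]
      rw [h0, add_zero, QuadraticMap.map_smul, smul_eq_mul, Finset.card_empty]
      push_cast
      linarith
    | insert n N hn ih =>
      intro h
      have ih' := ih fun k hk => h k (Finset.mem_insert_of_mem hk)
      obtain ⟨hnT, s, hs, hadj⟩ := h n (Finset.mem_insert_self _ _)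
      obtain ⟨a, ha⟩ := exists_joins_of_adj hadj hs
      rw [indicator_insert hn, ← add_assoc, QuadraticMap.map_add G.titsForm,
        QuadraticMap.polar_add_left, QuadraticMap.polar_smul_left, Finset.card_insert_of_notMem hn]
      have h1 := polar_indicator_le hnT {a} (by simpa using ha)
      have h2 := polar_indicator_le (G := G) hn ∅ (by simp)
      have h3 := titsForm_single_le G n
      simp only [Finset.card_singleton, Finset.card_empty, smul_eq_mul] at h1 h2 ⊢
      push_cast at h1 h2 ⊢
      linarith
  by_contra! hcard
  obtain ⟨n, hn⟩ : N.Nonempty := Finset.card_pos.1 (by omega)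
  have h1 := key N hN
  refine absurd (hq ((2 : ℤ) • indicator T + indicator N) fun h0 => ?_) (by omega)
  have := congrFun h0 n
  simp [indicator, hn, (hN n hn).1] at this

end Segments

/-- A positive definite Tits form excludes the subgraphs with a vector of nonpositive value. -/
theorem false_of_subgraph (hq : G.titsForm.PosDef) {n : ℕ} {f : Fin n → V}
    (hf : Function.Injective f) {c : Fin n → ℤ} (hc : ∀ i, 0 < c i) (hn : 0 < n)
    (L : Finset (Fin n × Fin n)) (hL : ∀ p ∈ L, p.1 < p.2)
    (hadj : ∀ p ∈ L, G.toSimpleGraph.Adj (f p.1) (f p.2))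
    (hle : ∑ i, c i ^ 2 ≤ ∑ p ∈ L, c p.1 * c p.2) : False := by
  classical
  -- Extension by zero is nonnegative, so arrows outside the subgraph only lower the form.
  let z : V → ℤ := Function.extend f c 0
  have hz : ∀ i, z (f i) = c i := fun i => hf.extend_apply c 0 i
  have hz0 : ∀ x, 0 ≤ z x := by
    intro x
    by_cases hx : ∃ i, f i = x
    · obtain ⟨i, rfl⟩ := hx
      rw [hz]; exact (hc i).le
    · exact (Function.extend_apply' c (0 : V → ℤ) x hx).ge
  have h1 : ∑ x, z x ^ 2 = ∑ i, c i ^ 2 := by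
    rw [← Finset.sum_subset (Finset.subset_univ (Finset.univ.image f)),
      Finset.sum_image fun i _ j _ h => hf h]
    · exact Finset.sum_congr rfl fun i _ => by rw [hz]
    · intro x _ hx
      have : z x = 0 := Function.extend_apply' c (0 : V → ℤ) x fun ⟨i, hi⟩ =>
        hx (Finset.mem_image.2 ⟨i, Finset.mem_univ i, hi⟩)
      rw [this]; rfl
  have hex : ∀ p : L, ∃ a, s(G.src a, G.tgt a) = s(f p.1.1, f p.1.2) := by
    intro p
    obtain ⟨-, a, ⟨h1, h2⟩ | ⟨h1, h2⟩⟩ := adj_iff.1 (hadj p.1 p.2)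
    · exact ⟨a, by rw [h1, h2]⟩
    · exact ⟨a, by rw [h1, h2]; exact Sym2.eq_swap⟩
  choose α hα using hex
  have hαinj : Function.Injective α := by
    intro p p' h
    have h2 := (hα p).symm.trans (h ▸ hα p')
    have hp := hL p.1 p.2
    have hp' := hL p'.1 p'.2
    rcases Sym2.eq_iff.1 h2 with ⟨h3, h4⟩ | ⟨h3, h4⟩
    · exact Subtype.ext (Prod.ext (hf h3) (hf h4))
    · rw [hf h3, hf h4] at hp
      exact (lt_asymm hp hp').elim
  have h2 : ∑ p ∈ L, c p.1 * c p.2 ≤ ∑ a, z (G.src a) * z (G.tgt a) := by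
    rw [← Finset.sum_coe_sort]
    calc ∑ p : L, c p.1.1 * c p.1.2 = ∑ p : L, z (G.src (α p)) * z (G.tgt (α p)) := by
          refine Finset.sum_congr rfl fun p _ => ?_
          rcases Sym2.eq_iff.1 (hα p) with ⟨h3, h4⟩ | ⟨h3, h4⟩
          · rw [h3, h4, hz, hz]
          · rw [h3, h4, hz, hz, mul_comm]
      _ = ∑ a ∈ Finset.univ.image α, z (G.src a) * z (G.tgt a) := by
          rw [Finset.sum_image fun i _ j _ h => hαinj h]
      _ ≤ _ := Finset.sum_le_sum_of_subset_of_nonneg (Finset.subset_univ _)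
          fun a _ _ => mul_nonneg (hz0 _) (hz0 _)
  have h3 := hq z fun h => (hc ⟨0, hn⟩).ne' (by rw [← hz, h]; rfl)
  rw [titsForm_apply, h1] at h3
  omega

/-- A biquiver with positive definite Tits form is obtained from its underlying graph. -/
theorem isObtainedFrom_of_adj_iff (hq : G.titsForm.PosDef) {W : Type*} {D : SimpleGraph W}
    (e : W ≃ V) (he : ∀ i j, G.toSimpleGraph.Adj (e i) (e j) ↔ D.Adj i j) :
    G.IsObtainedFrom D := by
  classical
  have hadj : ∀ a, D.Adj (e.symm (G.src a)) (e.symm (G.tgt a)) := by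
    intro a
    rw [← he, e.apply_symm_apply, e.apply_symm_apply]
    exact adj_iff.2 ⟨src_ne_tgt hq a, a, Or.inl ⟨rfl, rfl⟩⟩
  let g : E → D.edgeSet := fun a => ⟨s(e.symm (G.src a), e.symm (G.tgt a)), hadj a⟩
  have hg : Function.Bijective g := by
    constructor
    · intro a b hab
      have hS : G.titsForm (indicator {G.src a}) ≤ 1 := by
        rw [indicator_singleton]; exact titsForm_single_le G _
      have hne : G.tgt a ∉ ({G.src a} : Finset V) := by
        rw [Finset.mem_singleton]; exact (src_ne_tgt hq a).symm
      refine eq_of_joins hq hS hne (Or.inl ⟨Finset.mem_singleton_self _, rfl⟩) ?_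
      rcases Sym2.eq_iff.1 (congrArg Subtype.val hab) with ⟨h1, h2⟩ | ⟨h1, h2⟩
      · exact Or.inl ⟨Finset.mem_singleton.2 (e.symm.injective h1).symm, (e.symm.injective h2).symm⟩
      · exact Or.inr ⟨(e.symm.injective h2).symm, Finset.mem_singleton.2 (e.symm.injective h1).symm⟩
    · rintro ⟨p, hp⟩
      induction p using Sym2.inductionOn with
      | hf i j =>
        obtain ⟨-, a, ⟨h1, h2⟩ | ⟨h1, h2⟩⟩ := adj_iff.1 ((he i j).2 hp)
        · exact ⟨a, Subtype.ext (by simp [g, h1, h2])⟩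
        · exact ⟨a, Subtype.ext (by simp [g, h1, h2])⟩
  exact ⟨e.symm, Equiv.ofBijective g hg, fun a => rfl⟩

theorem isObtainedFrom_pathGraph (hq : G.titsForm.PosDef) {m : ℕ} {x : ℕ → V}
    (h : G.IsPathMap m x) (hall : ∀ y, ∃ i < m, x i = y) : G.IsObtainedFrom (dynkinA m) := by
  classical
  let e : Fin m ≃ V := Equiv.ofBijective (fun i => x i)
    ⟨fun i j hij => Fin.ext (h.1 _ i.2 _ j.2 hij), fun y => by
      obtain ⟨i, hi, rfl⟩ := hall y
      exact ⟨⟨i, hi⟩, rfl⟩⟩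
  refine isObtainedFrom_of_adj_iff hq e fun i j => ?_
  rw [dynkinA, SimpleGraph.pathGraph_adj]
  exact h.adj_iff hq i.2 j.2

theorem isObtainedFrom_branchGraph (hq : G.titsForm.PosDef) {m k : ℕ} {x : ℕ → V} {y : V}
    (h : G.IsPathMap m x) (hy : ∀ i < m, x i ≠ y) (hk : k < m)
    (hadj : G.toSimpleGraph.Adj (x k) y) (hall : ∀ w, (∃ i < m, x i = w) ∨ w = y) :
    G.IsObtainedFrom (branchGraph (m + 1) k) := by
  classical
  let e : Fin (m + 1) ≃ V := Equiv.ofBijective (fun i => if i.val < m then x i else y)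
    ⟨fun i j hij => by
      have hi := i.2
      have hj := j.2
      dsimp only at hij
      split_ifs at hij with h1 h2 h2
      · exact Fin.ext (h.1 _ h1 _ h2 hij)
      · exact (hy _ h1 hij).elim
      · exact (hy _ h2 hij.symm).elim
      · exact Fin.ext (by omega), fun w => by
      rcases hall w with ⟨i, hi, rfl⟩ | rfl
      · exact ⟨⟨i, by omega⟩, if_pos hi⟩
      · exact ⟨⟨m, by omega⟩, if_neg (lt_irrefl m)⟩⟩
  have hlast : ∀ i < m, G.toSimpleGraph.Adj (x i) y ↔ i = k := by
    refine fun i hi => ⟨fun hiy => ?_, fun hik => hik ▸ hadj⟩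
    refine h.1 _ hi _ hk (eq_of_adj hq (h.titsForm_segment_le (Nat.zero_le (m - 1)) (by omega))
      (fun hmem => ?_) (mem_segment.2 ⟨i, by omega, rfl⟩) (mem_segment.2 ⟨k, by omega, rfl⟩)
      hiy hadj)
    obtain ⟨l, hl, hly⟩ := mem_segment.1 hmem
    exact hy l (by omega) hly
  refine isObtainedFrom_of_adj_iff hq e fun i j => ?_
  have hi := i.2
  have hj := j.2
  have he : ∀ i, e i = if i.val < m then x i else y := fun i => rfl
  rw [branchGraph_adj, he, he, ne_eq, Fin.ext_iff]
  by_cases h1 : i.val < m <;> by_cases h2 : j.val < m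
  · rw [if_pos h1, if_pos h2, h.adj_iff hq h1 h2]
    omega
  · rw [if_pos h1, if_neg h2, hlast _ h1]
    omega
  · rw [if_neg h1, if_pos h2, SimpleGraph.adj_comm, hlast _ h2]
    omega
  · rw [if_neg h1, if_neg h2]
    exact iff_of_false (fun h => h.ne rfl) (by omega)

/-- The coefficients are the null vector of extended E₆: the squares and the edge products both sum
to 24. For extended E₇ and E₈ below the sums are 48 and 120. -/
theorem false_of_extendedE6 (hq : G.titsForm.PosDef) {x : ℕ → V} (h : G.IsPathMap 5 x) {v w : V}
    (hv : ∀ i < 5, x i ≠ v) (hw : ∀ i < 5, x i ≠ w) (hxv : G.toSimpleGraph.Adj (x 2) v)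
    (hvw : G.toSimpleGraph.Adj v w) : False := by
  have hvw' := hvw.ne
  refine false_of_subgraph hq (n := 7)
    (f := fun i => if i.val < 5 then x i else if i.val = 5 then v else w)
    (c := ![1, 2, 3, 2, 1, 2, 1]) (fun i j hij => ?_) (by decide) (by norm_num)
    {(0, 1), (1, 2), (2, 3), (3, 4), (2, 5), (5, 6)} (by decide) ?_ (by decide)
  · have hi := i.2
    have hj := j.2
    dsimp only at hij
    refine Fin.ext ?_
    split_ifs at hij with h1 h2 h3 h4 h5 h6 h7 h8
    · exact h.1 _ h1 _ h2 hij
    · exact (hv _ h1 hij).elim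
    · exact (hw _ h1 hij).elim
    · exact (hv _ h5 hij.symm).elim
    · omega
    · exact (hvw' hij).elim
    · exact (hw _ h7 hij.symm).elim
    · exact (hvw' hij.symm).elim
    · omega
  · intro p hp
    simp only [Finset.mem_insert, Finset.mem_singleton] at hp
    rcases hp with rfl | rfl | rfl | rfl | rfl | rfl
    · exact h.2 0 (by norm_num)
    · exact h.2 1 (by norm_num)
    · exact h.2 2 (by norm_num)
    · exact h.2 3 (by norm_num)
    · exact hxv
    · exact hvw

theorem false_of_extendedE7 (hq : G.titsForm.PosDef) {x : ℕ → V} (h : G.IsPathMap 7 x) {v : V}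
    (hv : ∀ i < 7, x i ≠ v) (hxv : G.toSimpleGraph.Adj (x 3) v) : False := by
  refine false_of_subgraph hq (injective_of_isPathMap h hv)
    (c := ![1, 2, 3, 4, 3, 2, 1, 2]) (by decide) (by norm_num)
    {(0, 1), (1, 2), (2, 3), (3, 4), (4, 5), (5, 6), (3, 7)} (by decide) ?_ (by decide)
  intro p hp
  simp only [Finset.mem_insert, Finset.mem_singleton] at hp
  rcases hp with rfl | rfl | rfl | rfl | rfl | rfl | rfl
  · exact h.2 0 (by norm_num)
  · exact h.2 1 (by norm_num)
  · exact h.2 2 (by norm_num)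
  · exact h.2 3 (by norm_num)
  · exact h.2 4 (by norm_num)
  · exact h.2 5 (by norm_num)
  · exact hxv

theorem false_of_extendedE8 (hq : G.titsForm.PosDef) {x : ℕ → V} (h : G.IsPathMap 8 x) {v : V}
    (hv : ∀ i < 8, x i ≠ v) (hxv : G.toSimpleGraph.Adj (x 2) v) : False := by
  refine false_of_subgraph hq (injective_of_isPathMap h hv)
    (c := ![2, 4, 6, 5, 4, 3, 2, 1, 3]) (by decide) (by norm_num)
    {(0, 1), (1, 2), (2, 3), (3, 4), (4, 5), (5, 6), (6, 7), (2, 8)} (by decide) ?_ (by decide)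
  intro p hp
  simp only [Finset.mem_insert, Finset.mem_singleton] at hp
  rcases hp with rfl | rfl | rfl | rfl | rfl | rfl | rfl | rfl
  · exact h.2 0 (by norm_num)
  · exact h.2 1 (by norm_num)
  · exact h.2 2 (by norm_num)
  · exact h.2 3 (by norm_num)
  · exact h.2 4 (by norm_num)
  · exact h.2 5 (by norm_num)
  · exact h.2 6 (by norm_num)
  · exact hxv

/-- A branch vertex of a longest path. -/
theorem isDynkin_of_branch (hG : G.Connected) (hq : G.titsForm.PosDef) {m k : ℕ} {x : ℕ → V}
    {v : V} (h : G.IsPathMap m x) (hmax : ∀ m' x', G.IsPathMap m' x' → m' ≤ m)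
    (hv : ∀ i < m, x i ≠ v) (hk : 0 < k) (hkm : 2 * k + 1 ≤ m)
    (hadj : G.toSimpleGraph.Adj (x k) v) : G.IsDynkin := by
  classical
  have hend : ∀ x', G.IsPathMap m x' → ∀ w, (∀ i < m, x' i ≠ w) →
      ¬ G.toSimpleGraph.Adj w (x' 0) := by
    intro x' hx' w hw ha
    have := hmax _ _ (hx'.cons hw ha)
    omega
  -- A further vertex `w` would be adjacent either to `v`, giving extended E₆ or a longer path, or
  -- to the path, giving an extended D or a longer path.
  have hall : ∀ y, (∃ i < m, x i = y) ∨ y = v := by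
    by_contra! hcon
    obtain ⟨y, hy, hyv⟩ := hcon
    obtain ⟨s, w, hs, hw, hsw⟩ := hG.exists_adj (S := insert v (segment x 0 (m - 1)))
      ⟨v, Finset.mem_insert_self _ _⟩ (y := y) (by
        rw [Finset.mem_insert, mem_segment]
        rintro (rfl | ⟨i, hi, hiy⟩)
        · exact hyv rfl
        · exact hy i (by omega) hiy)
    rw [Finset.mem_insert, mem_segment, not_or] at hw
    have hwv : w ≠ v := hw.1
    have hwx : ∀ i < m, x i ≠ w := fun i hi hiw => hw.2 ⟨i, by omega, hiw⟩
    rcases Finset.mem_insert.1 hs with rfl | hs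
    · rcases Nat.lt_or_ge 1 k with hk1 | hk1
      · refine false_of_extendedE6 hq (h.sub (r := 5) (s := k - 2) (by omega))
          (fun i hi => hv _ (by omega)) (fun i hi => hwx _ (by omega)) ?_ hsw
        rwa [show k - 2 + 2 = k by omega]
      · obtain rfl : k = 1 := by omega
        obtain ⟨n, rfl⟩ : ∃ n, m = n + 1 := ⟨m - 1, by omega⟩
        -- Replacing `x 0` by `s` gives another path with `m` vertices, which `w` would lengthen.
        have h1 := h.tail.cons (w := s) (fun i hi => hv _ (by omega)) hadj.symm
        refine hend _ h1 w (fun i hi => ?_) (by simpa using hsw.symm)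
        split_ifs with hi0
        · exact hwv.symm
        · exact hwx _ (by omega)
    · obtain ⟨j, hj, rfl⟩ := mem_segment.1 hs
      have hj0 : j ≠ 0 := by
        rintro rfl
        exact hend x h w hwx hsw.symm
      have hjm : j ≠ m - 1 := by
        rintro rfl
        exact hend _ h.reverse w (fun i hi => hwx _ (by omega)) hsw.symm
      -- The segment between the branch points `j` and `k` would have four neighbours: one path
      -- vertex beyond each end, `v` and `w`.
      have hN := card_neighbors_le_three hq
        (h.titsForm_segment_le (j := min j k) (l := max j k) (by omega) (by omega))
        (N := {x (min j k - 1), x (max j k + 1), v, w}) (by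
          intro n hn
          simp only [Finset.mem_insert, Finset.mem_singleton] at hn
          rcases hn with rfl | rfl | rfl | rfl
          · refine ⟨h.notMem_segment (by omega) (by omega) (by omega), x (min j k),
              mem_segment.2 ⟨_, by omega, rfl⟩, ?_⟩
            rw [h.adj_iff hq (by omega) (by omega)]
            omega
          · refine ⟨h.notMem_segment (by omega) (by omega) (by omega), x (max j k),
              mem_segment.2 ⟨_, by omega, rfl⟩, ?_⟩
            rw [h.adj_iff hq (by omega) (by omega)]
            omega
          · refine ⟨fun hmem => ?_, x k, mem_segment.2 ⟨_, by omega, rfl⟩, hadj⟩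
            obtain ⟨i, hi, hiv⟩ := mem_segment.1 hmem
            exact hv i (by omega) hiv
          · refine ⟨fun hmem => ?_, x j, mem_segment.2 ⟨_, by omega, rfl⟩, hsw⟩
            obtain ⟨i, hi, hiv⟩ := mem_segment.1 hmem
            exact hwx i (by omega) hiv)
      have h1 : x (min j k - 1) ≠ x (max j k + 1) := fun heq => by
        have := h.1 _ (by omega) _ (by omega) heq
        omega
      rw [Finset.card_insert_of_notMem, Finset.card_insert_of_notMem,
        Finset.card_pair hwv.symm] at hN
      · omega
      · simp only [Finset.mem_insert, Finset.mem_singleton, not_or]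
        exact ⟨hv _ (by omega), hwx _ (by omega)⟩
      · simp only [Finset.mem_insert, Finset.mem_singleton, not_or]
        exact ⟨h1, hv _ (by omega), hwx _ (by omega)⟩
  -- The arms at `x k` have lengths 1, k and m − 1 − k ≥ k. Length k = 1 is type D, with the path
  -- reversed to match the numbering of `dynkinD`; k = 2 allows only 5 ≤ m ≤ 7 by extended E₈; k ≥ 3
  -- contains extended E₇.
  rcases (by omega : k = 1 ∨ k = 2 ∨ 3 ≤ k) with rfl | rfl | hk3
  · refine Or.inr (Or.inl ⟨m + 1, by omega, ?_⟩)
    rw [dynkinD]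
    refine isObtainedFrom_branchGraph hq h.reverse (fun i hi => hv _ (by omega))
      (k := m + 1 - 3) (by omega) ?_ (y := v) fun w => ?_
    · rwa [show m - 1 - (m + 1 - 3) = 1 by omega]
    · rcases hall w with ⟨i, hi, rfl⟩ | rfl
      · exact Or.inl ⟨m - 1 - i, by omega, by rw [show m - 1 - (m - 1 - i) = i by omega]⟩
      · exact Or.inr rfl
  · have hm : m ≤ 7 := by
      by_contra! hm
      refine false_of_extendedE8 hq (h.sub (r := 8) (s := 0) (by omega))
        (fun i hi => hv _ (by omega)) ?_
      simpa using hadj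
    have hobt := isObtainedFrom_branchGraph hq h hv (by omega) hadj hall
    rcases (by omega : m = 5 ∨ m = 6 ∨ m = 7) with rfl | rfl | rfl
    · exact Or.inr (Or.inr (Or.inl hobt))
    · exact Or.inr (Or.inr (Or.inr (Or.inl hobt)))
    · exact Or.inr (Or.inr (Or.inr (Or.inr hobt)))
  · refine (false_of_extendedE7 hq (h.sub (r := 7) (s := k - 3) (by omega))
      (fun i hi => hv _ (by omega)) ?_).elim
    rwa [show k - 3 + 3 = k by omega]

/-- A connected biquiver with positive definite Tits form is obtained from a Dynkin diagram. -/
theorem isDynkin_of_posDef (hG : G.Connected) (hq : G.titsForm.PosDef) : G.IsDynkin := by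
  classical
  obtain ⟨y₀⟩ := hG.nonempty
  -- Path sizes are bounded by the number of vertices, so minimizing the complement gives a longest
  -- path.
  obtain ⟨m, ⟨x, h⟩, hmin⟩ := exists_minimal_measure (P := fun m => ∃ x, G.IsPathMap m x)
    (fun m => Fintype.card V - m) ⟨1, fun _ => y₀, fun i hi j hj _ => by omega, fun i hi => by omega⟩
  have hmax : ∀ m' x', G.IsPathMap m' x' → m' ≤ m := by
    intro m' x' h'
    have := hmin m' ⟨x', h'⟩
    have := h'.le_card
    have := h.le_card
    omega
  have hm : 1 ≤ m := hmax 1 (fun _ => y₀) ⟨fun i hi j hj _ => by omega, fun i hi => by omega⟩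
  by_cases hall : ∀ y, ∃ i < m, x i = y
  · exact Or.inl ⟨m, hm, isObtainedFrom_pathGraph hq h hall⟩
  push Not at hall
  obtain ⟨y, hy⟩ := hall
  obtain ⟨s, v, hs, hv, hadj⟩ := hG.exists_adj (S := segment x 0 (m - 1))
    ⟨x 0, mem_segment.2 ⟨0, by omega, rfl⟩⟩ (y := y) fun hmem => by
      obtain ⟨i, hi, hiy⟩ := mem_segment.1 hmem
      exact hy i (by omega) hiy
  obtain ⟨k, hk, rfl⟩ := mem_segment.1 hs
  have hv' : ∀ i < m, x i ≠ v := fun i hi hiv => hv (mem_segment.2 ⟨i, by omega, hiv⟩)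
  have hk0 : k ≠ 0 := by
    rintro rfl
    have := hmax _ _ (h.cons hv' hadj.symm)
    omega
  have hkm : k ≠ m - 1 := by
    rintro rfl
    have := hmax _ _ (h.reverse.cons (fun i hi => hv' _ (by omega)) hadj.symm)
    omega
  -- Up to reversal, the branch vertex is at least as near to the start as to the end.
  rcases Nat.lt_or_ge m (2 * k + 1) with hlt | hge
  · refine isDynkin_of_branch hG hq h.reverse hmax (v := v) (fun i hi => hv' _ (by omega))
      (k := m - 1 - k) (by omega) (by omega) ?_
    rwa [show m - 1 - (m - 1 - k) = k by omega]
  · exact isDynkin_of_branch hG hq h hmax hv' (by omega) hge hadj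

end Biquiver

theorem theorem1 {V : Type*} {E : Type*} [Fintype V] [Fintype E] (G : Biquiver V E)
    (hG : G.Connected) :
    ((G.RepresentationFinite ↔ G.IsDynkin) ∧
      (G.RepresentationFinite ↔ G.titsForm.PosDef)) ∧
    (G.RepresentationFinite → ∀ z : V → ℕ,
      ((∃ A : G.Representation, A.Indecomposable ∧ A.dim = z) ↔
        G.titsForm (fun x => (z x : ℤ)) = 1) ∧
      (∀ A B : G.Representation, A.Indecomposable → B.Indecomposable →
        A.dim = z → B.dim = z → A.Isomorphic B)) := by
  have hfin : G.RepresentationFinite ↔ G.titsForm.PosDef :=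
    ⟨fun h => h.posDef, Biquiver.representationFinite_of_posDef hG⟩
  refine ⟨⟨hfin.trans ⟨Biquiver.isDynkin_of_posDef hG, fun h => h.posDef hG⟩, hfin⟩,
    fun hrep z => ?_⟩
  have hq := hfin.1 hrep
  obtain ⟨ε, hε⟩ := Biquiver.exists_isUntwisting hG hq
  rw [Biquiver.Representation.titsForm_eq_eulerForm]
  refine ⟨⟨?_, Biquiver.Representation.exists_indecomposable hq⟩, fun A B hA hB hAz hBz =>
    hA.isomorphic_of_dim_eq hq hε hB (hAz.trans hBz.symm)⟩
  rintro ⟨A, hA, rfl⟩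
  exact hA.eulerForm_eq_one hq hε
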